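/- **Setting.** Let $(\mathcal B,H,D)$ be a unital $\mathbb Z/2$-graded spectral triple: $\mathcal B\subset\mathbb B(H)$ is a unital $*$-algebra of even operators, $D$ is odd and self-adjoint, $a(D\pm i)^{-1}$ is compact and $[D,a]$ is bounded for all $a\in\mathcal B$. Assume the $C^2$-condition: there is a core $\mathcal C$ for $D^2$ such that every $a\in\mathcal B$ maps $\mathcal C$ into $\mathrm{Dom}\,D^2$ and $[D^2,a](D\pm i)^{-1}:(D\pm i)\mathcal C\to H$ is bounded. Put $$\pi^1(a)=\begin{pmatrix}a&0\\ [D,a]&a\end{pmatrix},\qquad \pi^2(a)=\begin{pmatrix}(D+i)a(D+i)^{-1}&0\\ [D^2,a](D+i)^{-1}&a\end{pmatrix}\qquad\text{on } H\oplus H,$$ and let $\mathcal B_1$, $\mathcal B_2$ be the operator algebras obtained by completing $\mathcal B$ in the representations $\pi^1$ and $\pi^1(a)\oplus\pi^2(a)\oplus\pi^2(a^*)^*$ respectively; $B$ is the norm closure of $\mathcal B$ in $\mathbb B(H)$. Let $\Omega^1_u(\mathcal B_1,\mathcal B_2)$ be the kernel of the multiplication $\mathcal B_1\otimes^h\mathcal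 B_2\to\mathcal B_1$ on the Haagerup tensor product, with $\delta(b)=1\otimes b-b\otimes1$, and let $\pi_D$, $\pi_{D^2}$, $\pi_D\circ\delta$ be the maps on $\Omega^1_u(\mathcal B_1,\mathcal B_2)$ determined by $a\,\delta(b)\mapsto a[D,b]$, $a\,\delta(b)\mapsto a[D^2,b]$ (an operator from $\mathrm{Dom}\,D$ to $H$) and $a\,\delta(b)\mapsto[D,a][D,b]$. Let $\mathcal X$ be a $\mathbb Z/2$-graded right inner product $\mathcal B_2$-module, with grading $\gamma$, and let $v:\mathcal X\to p\mathcal B_2^{2N}$ be an even, inner product preserving isomorphism, where $p=p^*=p^2\in M_{2N}(\mathcal B_2)$ and $\mathcal B_2^{2N}$ has $N$ even and $N$ odd basis vectors $e_i$. Put $x_i=v^*(e_i)$. Let $\mathcal X_v$ be the completion of $\mathcal X$ in the norm $\|v(x)\|_{\mathcal B_1^{2N}}$, and let $X\otimes_BH$ be the Hilbert space completion of the span of the $x\otimes h$ with $\langle x\otimes h,y\otimes k\rangle=\langle h,\langle x,y\rangle k\rangle$; the map $v$ induces an isometry $v:X\otimes_BH\to H^{2N}$ with adjoint $v^*$. Let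 $$\nabla:\mathcal X\to\mathcal X_v\otimes^{\rm alg}_{\mathcal B_1}\Omega^1_u(\mathcal B_1,\mathcal B_2)$$ be a $C^2$-connection: a linear map with $\nabla(\gamma x)=(\gamma\otimes1)\nabla(x)$ and $\nabla(xb)=\nabla(x)b+\gamma(x)\otimes\delta(b)$. Write $\nabla_D=(1\otimes\pi_D)\circ\nabla$ and $$(1\otimes_\nabla D)(x\otimes h)=\gamma(x)\otimes Dh+\nabla_D(x)h\quad(h\in\mathrm{Dom}\,D),$$ $$(1\otimes_\nabla D^2)(x\otimes h)=x\otimes D^2h+(\gamma\otimes\pi_{D^2})(\nabla(x))h\quad(h\in\mathrm{Dom}\,D^2),$$ on the spans of these $x\otimes h$. Let $R_{\nabla_D}=(1\otimes_\nabla D)^2-1\otimes_\nabla D^2$ be the curvature operator, $\nabla^v(x)=\sum_i\gamma(x_i)\otimes\delta(\langle x_i,x\rangle)$ the Grassmann connection and $\omega=\nabla-\nabla^v$ the connection form of $\nabla$. **Proposition.** The operators $1\otimes_\nabla D$ and $1\otimes_\nabla D^2$ are well defined. The domain of $R_{\nabla_D}$ is the span of the $x\otimes h$ with $x\in\mathcal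 X$, $h\in\mathrm{Dom}\,D^2$; it is dense in $X\otimes_BH$, and $R_{\nabla_D}$ extends to a bounded operator on $X\otimes_BH$. There is a bounded operator $\omega_D$ on $X\otimes_BH$ with $\omega_D(x\otimes h)=(1\otimes\pi_D)(\omega(x))h$, the projection $p$ preserves $(\mathrm{Dom}\,D)^{2N}\subset H^{2N}$, the commutator $[D,p]$ of $p$ with the operator $\gamma\otimes D$ on $H^{2N}$ (again denoted $D$) extends to a bounded operator, and the bounded extension of $R_{\nabla_D}$ is $$R_{\nabla_D}=v^*[D,p][D,p]v+\omega_D^2+v^*\pi_D(\delta(v\omega v^*))v .$$ Here $\pi_D(\delta(v\omega v^*))$ is the bounded operator on $H^{2N}$ with matrix entries $\varepsilon_i\,\pi_D(\delta(\omega_{ij}))$, where $\omega_{ij}=\langle x_i,\omega(x_j)\rangle\in\Omega^1_u(\mathcal B_1,\mathcal B_2)$ and $\varepsilon_i=\pm1$ is the degree sign of $e_i$, i.e. $\gamma(e_i)=\varepsilon_ie_i$. -/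

import Mathlib

open scoped TensorProduct InnerProductSpace

noncomputable section

namespace Curv

section Haagerup

variable {A₁ A₂ V W : Type*} [CStarAlgebra A₁] [CStarAlgebra A₂] [Ring V] [Algebra ℂ V]
  [Ring W] [Algebra ℂ W]

/-- `‖∑ xₖ xₖ*‖^{1/2} ‖∑ yₖ* yₖ‖^{1/2}`, for algebras `V`, `W` represented in `C*`-algebras by `jV`,
`jW`. -/
def haagCost (jV : V →ₐ[ℂ] A₁) (jW : W →ₐ[ℂ] A₂) {n : ℕ} (x : Fin n → V) (y : Fin n → W) : ℝ :=
  √(‖∑ k, jV (x k) * star (jV (x k))‖ * ‖∑ k, star (jW (y k)) * jW (y k)‖)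

/-- The algebraic tensor product of two algebras represented in `C*`-algebras. -/
def HaagAlg (jV : V →ₐ[ℂ] A₁) (jW : W →ₐ[ℂ] A₂) : Type _ := V ⊗[ℂ] W

instance (jV : V →ₐ[ℂ] A₁) (jW : W →ₐ[ℂ] A₂) : AddCommGroup (HaagAlg jV jW) :=
  inferInstanceAs (AddCommGroup (V ⊗[ℂ] W))

instance (jV : V →ₐ[ℂ] A₁) (jW : W →ₐ[ℂ] A₂) : Module ℂ (HaagAlg jV jW) :=
  inferInstanceAs (Module ℂ (V ⊗[ℂ] W))

/-- The identification of the plain tensor product with its copy carrying the Haagerup norm. -/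
def HaagAlg.of (jV : V →ₐ[ℂ] A₁) (jW : W →ₐ[ℂ] A₂) : V ⊗[ℂ] W ≃ₗ[ℂ] HaagAlg jV jW :=
  LinearEquiv.refl ℂ _

variable {jV : V →ₐ[ℂ] A₁} {jW : W →ₐ[ℂ] A₂}

/-- The element `∑ xₖ ⊗ yₖ`. -/
def haagSum (jV : V →ₐ[ℂ] A₁) (jW : W →ₐ[ℂ] A₂) {n : ℕ} (x : Fin n → V) (y : Fin n → W) : HaagAlg jV jW :=
  HaagAlg.of jV jW (∑ k, x k ⊗ₜ[ℂ] y k)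

/-- The Haagerup norm. -/
def haagNorm (z : HaagAlg jV jW) : ℝ :=
  sInf {r | ∃ (n : ℕ) (x : Fin n → V) (y : Fin n → W), z = haagSum jV jW x y ∧ r = haagCost jV jW x y}

theorem haagNorm_le {n : ℕ} (x : Fin n → V) (y : Fin n → W) :
    haagNorm (haagSum jV jW x y) ≤ haagCost jV jW x y :=
  csInf_le ⟨0, by rintro _ ⟨n, x, y, -, rfl⟩; exact Real.sqrt_nonneg _⟩ ⟨n, x, y, rfl, rfl⟩

theorem haagSum_append {n m : ℕ} (x : Fin n → V) (y : Fin n → W) (x' : Fin m → V)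
    (y' : Fin m → W) :
    haagSum jV jW (Fin.append x x') (Fin.append y y') = haagSum jV jW x y + haagSum jV jW x' y' := by
  unfold haagSum
  rw [Fin.sum_univ_add, map_add]
  simp

theorem haagSum_exists (z : HaagAlg jV jW) :
    ∃ (n : ℕ) (x : Fin n → V) (y : Fin n → W), z = haagSum jV jW x y := by
  obtain ⟨z, rfl⟩ := (HaagAlg.of jV jW).surjective z
  induction z using TensorProduct.induction_on with
  | zero => exact ⟨0, 0, 0, by simp [haagSum]⟩
  | tmul a b => exact ⟨1, fun _ => a, fun _ => b, by simp [haagSum]⟩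
  | add z w hz hw =>
    obtain ⟨n, x, y, hz⟩ := hz
    obtain ⟨m, x', y', hw⟩ := hw
    exact ⟨n + m, _, _, by rw [map_add, hz, hw]; exact (haagSum_append x y x' y').symm⟩

theorem le_haagNorm {z : HaagAlg jV jW} {c : ℝ}
    (h : ∀ (n : ℕ) (x : Fin n → V) (y : Fin n → W), z = haagSum jV jW x y → c ≤ haagCost jV jW x y) :
    c ≤ haagNorm z := by
  obtain ⟨n, x, y, hz⟩ := haagSum_exists z
  refine le_csInf ⟨_, n, x, y, hz, rfl⟩ ?_
  rintro _ ⟨n, x, y, hz, rfl⟩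
  exact h n x y hz

theorem haagNorm_nonneg (z : HaagAlg jV jW) : 0 ≤ haagNorm z :=
  le_haagNorm fun _ _ _ _ => Real.sqrt_nonneg _

theorem haagSum_smul {n : ℕ} (c : ℂ) (x : Fin n → V) (y : Fin n → W) :
    haagSum jV jW (fun k => c • x k) y = c • haagSum jV jW x y := by
  unfold haagSum
  simp only [← TensorProduct.smul_tmul', ← Finset.smul_sum, map_smul]

theorem haagRow_smul {n : ℕ} (c : ℂ) (x : Fin n → V) :
    ‖∑ k, jV (c • x k) * star (jV (c • x k))‖ =
      ‖c‖ ^ 2 * ‖∑ k, jV (x k) * star (jV (x k))‖ := by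
  have : ∀ k, jV (c • x k) * star (jV (c • x k)) =
      (c * star c) • (jV (x k) * star (jV (x k))) := by
    intro k
    simp [smul_smul, mul_comm]
  simp only [this, ← Finset.smul_sum, norm_smul]
  simp [sq]

theorem haagCol_smul {n : ℕ} (c : ℂ) (x : Fin n → W) :
    ‖∑ k, star (jW (c • x k)) * jW (c • x k)‖ =
      ‖c‖ ^ 2 * ‖∑ k, star (jW (x k)) * jW (x k)‖ := by
  have : ∀ k, star (jW (c • x k)) * jW (c • x k) =
      (star c * c) • (star (jW (x k)) * jW (x k)) := by
    intro k
    simp [smul_smul, mul_comm]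
  simp only [this, ← Finset.smul_sum, norm_smul]
  simp [sq]

theorem haagCost_smul {n : ℕ} (c : ℂ) (x : Fin n → V) (y : Fin n → W) :
    haagCost jV jW (fun k => c • x k) y = ‖c‖ * haagCost jV jW x y := by
  unfold haagCost
  rw [haagRow_smul, mul_assoc, Real.sqrt_mul (sq_nonneg _), Real.sqrt_sq (norm_nonneg _)]

theorem haag_balanced {z : HaagAlg jV jW} {r : ℝ} (hr : haagNorm z < r) :
    ∃ (n : ℕ) (x : Fin n → V) (y : Fin n → W), z = haagSum jV jW x y ∧
      ‖∑ k, jV (x k) * star (jV (x k))‖ ≤ r ∧ ‖∑ k, star (jW (y k)) * jW (y k)‖ ≤ r := by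
  have hr0 : 0 < r := (haagNorm_nonneg z).trans_lt hr
  obtain ⟨n, x, y, hz, hc⟩ : ∃ (n : ℕ) (x : Fin n → V) (y : Fin n → W),
      z = haagSum jV jW x y ∧ haagCost jV jW x y < r := by
    by_contra! hcon
    exact absurd (le_haagNorm hcon) (not_le.2 hr)
  have key : ∀ t : ℝ, 0 < t → z = haagSum jV jW (fun k => (t : ℂ) • x k) (fun k => ((t⁻¹ : ℝ) : ℂ) • y k) := by
    intro t ht
    rw [hz]
    unfold haagSum
    congr 1
    refine Finset.sum_congr rfl fun k _ => ?_
    rw [TensorProduct.smul_tmul_smul, ← Complex.ofReal_mul, mul_inv_cancel₀ ht.ne']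
    simp
  set A := ‖∑ k, jV (x k) * star (jV (x k))‖ with hA
  set B := ‖∑ k, star (jW (y k)) * jW (y k)‖ with hB
  have hA0 : 0 ≤ A := norm_nonneg _
  have hB0 : 0 ≤ B := norm_nonneg _
  have hAB : A * B < r ^ 2 := (Real.sqrt_lt' hr0).1 hc
  obtain ⟨s, hs, h1, h2⟩ : ∃ s : ℝ, 0 < s ∧ s * A ≤ r ∧ s⁻¹ * B ≤ r := by
    rcases hA0.eq_or_lt with h | h
    · refine ⟨(B + 1) / r, by positivity, by rw [← h]; simpa using hr0.le, ?_⟩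
      rw [inv_div, div_mul_eq_mul_div, div_le_iff₀ (by positivity)]
      nlinarith
    · refine ⟨r / A, by positivity, by field_simp; rfl, ?_⟩
      rw [inv_div, div_mul_eq_mul_div, div_le_iff₀ (by positivity)]
      nlinarith
  refine ⟨n, _, _, key (√s) (Real.sqrt_pos.2 hs), ?_, ?_⟩
  · rw [haagRow_smul]
    simpa [Real.sq_sqrt hs.le] using h1
  · rw [haagCol_smul]
    simpa [Real.sq_sqrt hs.le] using h2

theorem haagNorm_add_le (z w : HaagAlg jV jW) : haagNorm (z + w) ≤ haagNorm z + haagNorm w := by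
  refine le_of_forall_pos_le_add fun ε hε => ?_
  obtain ⟨n, x, y, hz, hx, hy⟩ := haag_balanced (lt_add_of_pos_right (haagNorm z) (half_pos hε))
  obtain ⟨m, x', y', hw, hx', hy'⟩ :=
    haag_balanced (lt_add_of_pos_right (haagNorm w) (half_pos hε))
  have h := haagNorm_le (jV := jV) (jW := jW) (Fin.append x x') (Fin.append y y')
  rw [haagSum_append, ← hz, ← hw] at h
  refine h.trans ?_
  unfold haagCost
  rw [Fin.sum_univ_add, Fin.sum_univ_add]
  simp only [Fin.append_left, Fin.append_right]
  have e : haagNorm z + haagNorm w + ε =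
      (haagNorm z + ε / 2) + (haagNorm w + ε / 2) := by ring
  have hpos : 0 ≤ haagNorm z + haagNorm w + ε := by
    have := haagNorm_nonneg z
    have := haagNorm_nonneg w
    positivity
  refine Real.sqrt_le_iff.2 ⟨hpos, ?_⟩
  rw [sq]
  refine mul_le_mul ?_ ?_ (norm_nonneg _) hpos
  · exact (norm_add_le _ _).trans (by rw [e]; exact add_le_add hx hx')
  · exact (norm_add_le _ _).trans (by rw [e]; exact add_le_add hy hy')

theorem haagNorm_zero : haagNorm (0 : HaagAlg jV jW) = 0 := by
  refine le_antisymm ?_ (haagNorm_nonneg _)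
  have h := haagNorm_le (jV := jV) (jW := jW) (n := 0) 0 0
  have e : haagSum jV jW (n := 0) 0 0 = 0 := by simp [haagSum]
  rw [e] at h
  exact h.trans (by simp [haagCost])

/-- The Haagerup norm as a seminorm on the algebraic tensor product. -/
def haagSeminorm (jV : V →ₐ[ℂ] A₁) (jW : W →ₐ[ℂ] A₂) : Seminorm ℂ (HaagAlg jV jW) :=
  Seminorm.ofSMulLE haagNorm
    haagNorm_zero
    haagNorm_add_le
    (fun c z => by
      rcases eq_or_ne c 0 with rfl | hc
      · simp [haagNorm_zero]
      · rw [← div_le_iff₀' (norm_pos_iff.2 hc)]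
        refine le_haagNorm fun n x y hz => ?_
        rw [div_le_iff₀' (norm_pos_iff.2 hc), ← haagCost_smul, hz, ← haagSum_smul]
        exact haagNorm_le _ _)

instance : SeminormedAddCommGroup (HaagAlg jV jW) :=
  (haagSeminorm jV jW).toAddGroupSeminorm.toSeminormedAddCommGroup

theorem haag_norm_def (z : HaagAlg jV jW) : ‖z‖ = haagNorm z := rfl

instance : NormedSpace ℂ (HaagAlg jV jW) where
  norm_smul_le c z := (map_smul_eq_mul (haagSeminorm jV jW) c z).le

variable (jV jW) in
/-- The Haagerup tensor product `V ⊗ʰ W` of two concrete operator algebras. -/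
def Haag : Type _ := UniformSpace.Completion (HaagAlg jV jW)

instance : NormedAddCommGroup (Haag jV jW) :=
  inferInstanceAs (NormedAddCommGroup (UniformSpace.Completion (HaagAlg jV jW)))

instance : NormedSpace ℂ (Haag jV jW) :=
  inferInstanceAs (NormedSpace ℂ (UniformSpace.Completion (HaagAlg jV jW)))

instance : CompleteSpace (Haag jV jW) :=
  inferInstanceAs (CompleteSpace (UniformSpace.Completion (HaagAlg jV jW)))

variable (jV jW) in
/-- The isometric dense embedding of the algebraic tensor product into its completion. -/
def haagEmb : HaagAlg jV jW →L[ℂ] Haag jV jW :=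
  (UniformSpace.Completion.toComplL :
    HaagAlg jV jW →L[ℂ] UniformSpace.Completion (HaagAlg jV jW))

theorem denseRange_haagEmb : DenseRange (haagEmb jV jW) :=
  UniformSpace.Completion.denseRange_coe

theorem isUniformInducing_haagEmb : IsUniformInducing (haagEmb jV jW) :=
  UniformSpace.Completion.isUniformInducing_coe _

theorem norm_haagEmb (z : HaagAlg jV jW) : ‖haagEmb jV jW z‖ = ‖z‖ :=
  UniformSpace.Completion.norm_coe z

/-- The canonical map of the algebraic tensor product to `V ⊗ʰ W`. -/
def haagOf (jV : V →ₐ[ℂ] A₁) (jW : W →ₐ[ℂ] A₂) : V ⊗[ℂ] W →ₗ[ℂ] Haag jV jW :=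
  (haagEmb jV jW).toLinearMap ∘ₗ (HaagAlg.of jV jW).toLinearMap

/-- The continuous extension to `V ⊗ʰ W` of a Haagerup-bounded linear map. -/
def haagLift {P : Type*} [NormedAddCommGroup P] [NormedSpace ℂ P] [CompleteSpace P]
    (f : V ⊗[ℂ] W →ₗ[ℂ] P) (C : ℝ) (hC : 0 ≤ C)
    (hf : ∀ (n : ℕ) (x : Fin n → V) (y : Fin n → W),
      ‖f (∑ k, x k ⊗ₜ[ℂ] y k)‖ ≤ C * haagCost jV jW x y) : Haag jV jW →L[ℂ] P :=
  ((f ∘ₗ (HaagAlg.of jV jW).symm.toLinearMap).mkContinuous C (fun z => by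
    rcases hC.eq_or_lt with h | h
    · obtain ⟨n, x, y, rfl⟩ := haagSum_exists z
      have := hf n x y
      rw [← h, zero_mul] at this
      rw [← h, zero_mul]
      exact this
    · rw [haag_norm_def, ← div_le_iff₀' h]
      refine le_haagNorm fun n x y hz => ?_
      rw [div_le_iff₀' h, hz]
      exact hf n x y)).extend (haagEmb jV jW)

theorem haagLift_of {P : Type*} [NormedAddCommGroup P] [NormedSpace ℂ P] [CompleteSpace P]
    (f : V ⊗[ℂ] W →ₗ[ℂ] P) (C : ℝ) (hC : 0 ≤ C)
    (hf : ∀ (n : ℕ) (x : Fin n → V) (y : Fin n → W),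
      ‖f (∑ k, x k ⊗ₜ[ℂ] y k)‖ ≤ C * haagCost jV jW x y) (z : V ⊗[ℂ] W) :
    haagLift f C hC hf (haagOf jV jW z) = f z :=
  ContinuousLinearMap.extend_eq _ denseRange_haagEmb isUniformInducing_haagEmb
    (HaagAlg.of jV jW z)

/-- Two continuous linear maps on `V ⊗ʰ W` agree if they agree on elementary tensors. -/
theorem haag_ext {P : Type*} [NormedAddCommGroup P] [NormedSpace ℂ P]
    {f g : Haag jV jW →L[ℂ] P}
    (h : ∀ a b, f (haagOf jV jW (a ⊗ₜ b)) = g (haagOf jV jW (a ⊗ₜ b))) : f = g := by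
  have h' : f.toLinearMap ∘ₗ haagOf jV jW = g.toLinearMap ∘ₗ haagOf jV jW :=
    TensorProduct.ext' h
  refine DFunLike.coe_injective (denseRange_haagEmb.equalizer f.continuous g.continuous ?_)
  exact funext fun z => LinearMap.congr_fun h' ((HaagAlg.of jV jW).symm z)

theorem norm_haagOf_sum_le {n : ℕ} (x : Fin n → V) (y : Fin n → W) :
    ‖haagOf jV jW (∑ k, x k ⊗ₜ[ℂ] y k)‖ ≤ haagCost jV jW x y := by
  change ‖haagEmb jV jW (haagSum jV jW x y)‖ ≤ _
  rw [norm_haagEmb, haag_norm_def]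
  exact haagNorm_le x y

/-- Left multiplication by `a` on `V ⊗ʰ W`. -/
def haagLmul (a : V) : Haag jV jW →L[ℂ] Haag jV jW :=
  haagLift (haagOf jV jW ∘ₗ TensorProduct.map (LinearMap.mulLeft ℂ a) LinearMap.id) ‖jV a‖
    (norm_nonneg _) (fun n x y => by
      simp only [map_sum, LinearMap.comp_apply, TensorProduct.map_tmul, LinearMap.mulLeft_apply,
        LinearMap.id_apply]
      rw [← map_sum]
      refine (norm_haagOf_sum_le (fun k => a * x k) y).trans ?_
      unfold haagCost
      rw [← Real.sqrt_sq (norm_nonneg (jV a)), ← Real.sqrt_mul (sq_nonneg _), ← mul_assoc]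
      refine Real.sqrt_le_sqrt (mul_le_mul_of_nonneg_right ?_ (norm_nonneg _))
      have e : ∑ k, jV (a * x k) * star (jV (a * x k)) =
          jV a * (∑ k, jV (x k) * star (jV (x k))) * star (jV a) := by
        simp [Finset.mul_sum, Finset.sum_mul, mul_assoc]
      rw [e]
      refine (norm_mul_le _ _).trans ?_
      rw [norm_star]
      refine (mul_le_mul_of_nonneg_right (norm_mul_le _ _) (norm_nonneg _)).trans (le_of_eq ?_)
      ring)

/-- Right multiplication by `b` on `V ⊗ʰ W`. -/
def haagRmul (b : W) : Haag jV jW →L[ℂ] Haag jV jW :=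
  haagLift (haagOf jV jW ∘ₗ TensorProduct.map LinearMap.id (LinearMap.mulRight ℂ b)) ‖jW b‖
    (norm_nonneg _) (fun n x y => by
      simp only [map_sum, LinearMap.comp_apply, TensorProduct.map_tmul, LinearMap.mulRight_apply,
        LinearMap.id_apply]
      rw [← map_sum]
      refine (norm_haagOf_sum_le x (fun k => y k * b)).trans ?_
      unfold haagCost
      rw [← Real.sqrt_sq (norm_nonneg (jW b)), ← Real.sqrt_mul (sq_nonneg _), mul_left_comm]
      refine Real.sqrt_le_sqrt (mul_le_mul_of_nonneg_left ?_ (norm_nonneg _))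
      have e : ∑ k, star (jW (y k * b)) * jW (y k * b) =
          star (jW b) * (∑ k, star (jW (y k)) * jW (y k)) * jW b := by
        simp [Finset.mul_sum, Finset.sum_mul, mul_assoc]
      rw [e]
      refine (norm_mul_le _ _).trans ?_
      refine (mul_le_mul_of_nonneg_right (norm_mul_le _ _) (norm_nonneg _)).trans (le_of_eq ?_)
      rw [norm_star]
      ring)

theorem haagLmul_tmul (a b : V) (c : W) :
    haagLmul a (haagOf jV jW (b ⊗ₜ c)) = haagOf jV jW ((a * b) ⊗ₜ c) :=
  haagLift_of _ _ _ _ _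

theorem haagRmul_tmul (a : V) (b c : W) :
    haagRmul b (haagOf jV jW (a ⊗ₜ c)) = haagOf jV jW (a ⊗ₜ (c * b)) :=
  haagLift_of _ _ _ _ _

theorem haagLmul_add (a a' : V) : (haagLmul (a + a') : Haag jV jW →L[ℂ] _) =
    haagLmul a + haagLmul a' :=
  haag_ext fun b c => by
    simp only [add_apply, haagLmul_tmul, add_mul, TensorProduct.add_tmul, map_add]

theorem haagLmul_smul (r : ℂ) (a : V) : (haagLmul (r • a) : Haag jV jW →L[ℂ] _) =
    r • haagLmul a :=
  haag_ext fun b c => by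
    simp only [smul_apply, haagLmul_tmul, smul_mul_assoc,
      ← TensorProduct.smul_tmul', map_smul]

theorem haagLmul_mul (a a' : V) (z : Haag jV jW) :
    haagLmul (a * a') z = haagLmul a (haagLmul a' z) := by
  have h : (haagLmul (a * a') : Haag jV jW →L[ℂ] _) = haagLmul a ∘L haagLmul a' :=
    haag_ext fun b c => by
      simp only [ContinuousLinearMap.comp_apply, haagLmul_tmul, mul_assoc]
  exact DFunLike.congr_fun h z

theorem haagLmul_rmul (a : V) (b : W) (z : Haag jV jW) :
    haagLmul a (haagRmul b z) = haagRmul b (haagLmul a z) := by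
  have h : (haagLmul a : Haag jV jW →L[ℂ] _) ∘L haagRmul b = haagRmul b ∘L haagLmul a :=
    haag_ext fun c d => by
      simp only [ContinuousLinearMap.comp_apply, haagLmul_tmul, haagRmul_tmul]
  exact DFunLike.congr_fun h z

section Sandwich

variable {K F G : Type*} [NormedAddCommGroup K] [InnerProductSpace ℂ K] [CompleteSpace K]
  [NormedAddCommGroup F] [InnerProductSpace ℂ F] [CompleteSpace F]
  [NormedAddCommGroup G] [InnerProductSpace ℂ G] [CompleteSpace G]

theorem sum_norm_sq_le {n : ℕ} (c : Fin n → K →L[ℂ] K) (h : K) :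
    ∑ k, ‖c k h‖ ^ 2 ≤ ‖∑ k, star (c k) * c k‖ * ‖h‖ ^ 2 := by
  have e : ((∑ k, ‖c k h‖ ^ 2 : ℝ) : ℂ) = ⟪h, (∑ k, star (c k) * c k) h⟫_ℂ := by
    simp only [sum_apply, inner_sum, mul_apply_eq_comp,
      ContinuousLinearMap.star_eq_adjoint, ContinuousLinearMap.adjoint_inner_right,
      inner_self_eq_norm_sq_to_K]
    simp
  have h1 : ∑ k, ‖c k h‖ ^ 2 = ‖⟪h, (∑ k, star (c k) * c k) h⟫_ℂ‖ := by
    rw [← e, Complex.norm_real, Real.norm_of_nonneg (Finset.sum_nonneg fun _ _ => sq_nonneg _)]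
  rw [h1]
  refine (norm_inner_le_norm _ _).trans ?_
  have := (∑ k, star (c k) * c k).le_opNorm h
  nlinarith [norm_nonneg h]

theorem haagerup_estimate {n : ℕ} (a b : Fin n → K →L[ℂ] K) (M : K →L[ℂ] K) :
    ‖∑ k, a k * M * b k‖ ≤
      ‖M‖ * √(‖∑ k, a k * star (a k)‖ * ‖∑ k, star (b k) * b k‖) := by
  refine ContinuousLinearMap.opNorm_le_bound _ (by positivity) fun h => ?_
  set A := ‖∑ k, a k * star (a k)‖
  set B := ‖∑ k, star (b k) * b k‖
  set w := (∑ k, a k * M * b k) h with hw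
  have h1 : ‖w‖ ^ 2 ≤ ∑ k, ‖star (a k) w‖ * (‖M‖ * ‖b k h‖) := by
    have e : ((‖w‖ ^ 2 : ℝ) : ℂ) = ∑ k, ⟪star (a k) w, M (b k h)⟫_ℂ := by
      have : ((‖w‖ ^ 2 : ℝ) : ℂ) = ⟪w, w⟫_ℂ := by rw [inner_self_eq_norm_sq_to_K]; simp
      rw [this]
      nth_rewrite 2 [hw]
      simp only [sum_apply, inner_sum, mul_apply_eq_comp,
        ContinuousLinearMap.star_eq_adjoint, ContinuousLinearMap.adjoint_inner_left]
    have e2 : ‖w‖ ^ 2 = ‖∑ k, ⟪star (a k) w, M (b k h)⟫_ℂ‖ := by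
      rw [← e, Complex.norm_real, Real.norm_of_nonneg (sq_nonneg _)]
    rw [e2]
    refine (norm_sum_le _ _).trans (Finset.sum_le_sum fun k _ => ?_)
    exact (norm_inner_le_norm _ _).trans
      (mul_le_mul_of_nonneg_left (M.le_opNorm _) (norm_nonneg _))
  have h2 : ∑ k, ‖star (a k) w‖ ^ 2 ≤ A * ‖w‖ ^ 2 := by
    simpa using sum_norm_sq_le (fun k => star (a k)) w
  have h3 : ∑ k, ‖b k h‖ ^ 2 ≤ B * ‖h‖ ^ 2 := sum_norm_sq_le b h
  have h4 : ∑ k, ‖star (a k) w‖ * (‖M‖ * ‖b k h‖) ≤ ‖M‖ * √(A * B) * ‖h‖ * ‖w‖ := by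
    have : ∑ k, ‖star (a k) w‖ * (‖M‖ * ‖b k h‖) = ‖M‖ * ∑ k, ‖star (a k) w‖ * ‖b k h‖ := by
      rw [Finset.mul_sum]
      exact Finset.sum_congr rfl fun k _ => by ring
    rw [this, mul_assoc, mul_assoc]
    refine mul_le_mul_of_nonneg_left ?_ (norm_nonneg _)
    refine (Real.sum_mul_le_sqrt_mul_sqrt _ _ _).trans ?_
    refine (mul_le_mul (Real.sqrt_le_sqrt h2) (Real.sqrt_le_sqrt h3)
      (Real.sqrt_nonneg _) (Real.sqrt_nonneg _)).trans (le_of_eq ?_)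
    have hA : 0 ≤ A := norm_nonneg _
    rw [Real.sqrt_mul hA, Real.sqrt_mul (norm_nonneg _), Real.sqrt_mul hA,
      Real.sqrt_sq (norm_nonneg _), Real.sqrt_sq (norm_nonneg _)]
    ring
  rcases (norm_nonneg w).eq_or_lt with h0 | h0
  · rw [← h0]
    positivity
  · have := h1.trans h4
    rw [sq] at this
    exact le_of_mul_le_mul_right this h0

/-- The continuous linear extension to `V ⊗ʰ W` of `a ⊗ b ↦ L φ(a) M ψ(b) N`, where `φ`, `ψ` are
representations on `K`. -/
def haagSandwich (φ : A₁ →⋆ₐ[ℂ] (K →L[ℂ] K)) (ψ : A₂ →⋆ₐ[ℂ] (K →L[ℂ] K))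
    (L : K →L[ℂ] F) (M : K →L[ℂ] K) (N : G →L[ℂ] K) : Haag jV jW →L[ℂ] (G →L[ℂ] F) :=
  haagLift
    (((ContinuousLinearMap.compL ℂ G K F L).toLinearMap ∘ₗ
        ((ContinuousLinearMap.compL ℂ G K K).flip N).toLinearMap) ∘ₗ
      LinearMap.mul' ℂ (K →L[ℂ] K) ∘ₗ
      TensorProduct.map
        (LinearMap.mulRight ℂ M ∘ₗ φ.toAlgHom.toLinearMap ∘ₗ jV.toLinearMap)
        (ψ.toAlgHom.toLinearMap ∘ₗ jW.toLinearMap))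
    (‖L‖ * ‖M‖ * ‖N‖) (by positivity) (fun n x y => by
      have h := haagerup_estimate (fun k => φ (jV (x k))) (fun k => ψ (jW (y k))) M
      have hx : ‖∑ k, φ (jV (x k)) * star (φ (jV (x k)))‖ ≤ ‖∑ k, jV (x k) * star (jV (x k))‖ := by
        have : ∑ k, φ (jV (x k)) * star (φ (jV (x k))) = φ (∑ k, jV (x k) * star (jV (x k))) := by
          simp [map_sum, map_mul, map_star]
        rw [this]
        exact NonUnitalStarAlgHom.norm_apply_le φ _
      have hy : ‖∑ k, star (ψ (jW (y k))) * ψ (jW (y k))‖ ≤ ‖∑ k, star (jW (y k)) * jW (y k)‖ := by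
        have : ∑ k, star (ψ (jW (y k))) * ψ (jW (y k)) = ψ (∑ k, star (jW (y k)) * jW (y k)) := by
          simp [map_sum, map_mul, map_star]
        rw [this]
        exact NonUnitalStarAlgHom.norm_apply_le ψ _
      have h2 : ‖∑ k, φ (jV (x k)) * M * ψ (jW (y k))‖ ≤ ‖M‖ * haagCost jV jW x y :=
        h.trans (mul_le_mul_of_nonneg_left (Real.sqrt_le_sqrt
          (mul_le_mul hx hy (norm_nonneg _) (norm_nonneg _))) (norm_nonneg _))
      have e : ∀ T : K →L[ℂ] K, ‖L ∘L (T ∘L N)‖ ≤ ‖L‖ * ‖T‖ * ‖N‖ := fun T => by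
        refine (ContinuousLinearMap.opNorm_comp_le _ _).trans ?_
        rw [mul_assoc]
        exact mul_le_mul_of_nonneg_left (ContinuousLinearMap.opNorm_comp_le _ _) (norm_nonneg _)
      have e2 := e (∑ k, φ (jV (x k)) * M * ψ (jW (y k)))
      have e3 : ‖L‖ * ‖∑ k, φ (jV (x k)) * M * ψ (jW (y k))‖ * ‖N‖ ≤ ‖L‖ * ‖M‖ * ‖N‖ * haagCost jV jW x y := by
        have := mul_le_mul_of_nonneg_left h2 (norm_nonneg L)
        have := mul_le_mul_of_nonneg_right this (norm_nonneg N)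
        linarith
      refine le_trans (le_of_eq ?_) (e2.trans e3)
      simp only [LinearMap.comp_apply, map_sum, TensorProduct.map_tmul, LinearMap.mul'_apply]
      simp only [← map_sum]
      rfl)

theorem haagSandwich_tmul (φ : A₁ →⋆ₐ[ℂ] (K →L[ℂ] K)) (ψ : A₂ →⋆ₐ[ℂ] (K →L[ℂ] K))
    (L : K →L[ℂ] F) (M : K →L[ℂ] K) (N : G →L[ℂ] K) (a : V) (b : W) :
    haagSandwich φ ψ L M N (haagOf jV jW (a ⊗ₜ b)) =
      L ∘L ((φ (jV a) * M * ψ (jW b)) ∘L N) :=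
  haagLift_of _ _ _ _ _

end Sandwich

end Haagerup

section Triple

variable {H : Type*} [NormedAddCommGroup H] [InnerProductSpace ℂ H] [CompleteSpace H]

/-- The square `T²` of a partially defined operator, on `{x ∈ Dom T | T x ∈ Dom T}`. -/
def sqPMap {E : Type*} [AddCommGroup E] [Module ℂ E] (T : E →ₗ.[ℂ] E) : E →ₗ.[ℂ] E where
  domain :=
    { carrier := {x | ∃ h : x ∈ T.domain, T ⟨x, h⟩ ∈ T.domain}
      add_mem' := by
        rintro x y ⟨hx, hx'⟩ ⟨hy, hy'⟩
        refine ⟨T.domain.add_mem hx hy, ?_⟩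
        have : T ⟨x + y, T.domain.add_mem hx hy⟩ = T ⟨x, hx⟩ + T ⟨y, hy⟩ :=
          T.map_add ⟨x, hx⟩ ⟨y, hy⟩
        rw [this]
        exact T.domain.add_mem hx' hy'
      zero_mem' := ⟨T.domain.zero_mem, by
        have : T ⟨0, T.domain.zero_mem⟩ = 0 := T.map_zero
        rw [this]
        exact T.domain.zero_mem⟩
      smul_mem' := by
        rintro c x ⟨hx, hx'⟩
        refine ⟨T.domain.smul_mem c hx, ?_⟩
        have : T ⟨c • x, T.domain.smul_mem c hx⟩ = c • T ⟨x, hx⟩ := T.map_smul c ⟨x, hx⟩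
        rw [this]
        exact T.domain.smul_mem c hx' }
  toFun :=
    { toFun := fun x => T ⟨T ⟨x, x.2.1⟩, x.2.2⟩
      map_add' := fun x y => by
        rw [← T.map_add]
        congr 1
        exact Subtype.ext (T.map_add ⟨x, x.2.1⟩ ⟨y, y.2.1⟩)
      map_smul' := fun c x => by
        rw [RingHom.id_apply, ← T.map_smul]
        congr 1
        exact Subtype.ext (T.map_smul c ⟨x, x.2.1⟩) }

theorem sqPMap_domain_le {E : Type*} [AddCommGroup E] [Module ℂ E] (T : E →ₗ.[ℂ] E) :
    (sqPMap T).domain ≤ T.domain := fun _ h => h.1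

theorem sqPMap_apply {E : Type*} [AddCommGroup E] [Module ℂ E] (T : E →ₗ.[ℂ] E)
    (x : (sqPMap T).domain) : sqPMap T x = T ⟨T ⟨x, x.2.1⟩, x.2.2⟩ := rfl

/-- `a` preserves `Dom T`, and the bounded operator `c` extends the commutator `T a - a T`. -/
def IsCommutator {E : Type*} [NormedAddCommGroup E] [NormedSpace ℂ E] (T : E →ₗ.[ℂ] E)
    (a c : E →L[ℂ] E) : Prop :=
  ∀ (h : E) (hh : h ∈ T.domain), ∃ hah : a h ∈ T.domain, c h = T ⟨a h, hah⟩ - a (T ⟨h, hh⟩)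

/-- `T` anticommutes with `Γ`. -/
def IsOddOp (T : H →ₗ.[ℂ] H) (Γ : H →L[ℂ] H) : Prop :=
  ∀ (h : H) (hh : h ∈ T.domain), ∃ hΓ : Γ h ∈ T.domain, T ⟨Γ h, hΓ⟩ = -Γ (T ⟨h, hh⟩)

/-- The operator `a (T ± i)⁻¹` is compact for every `a` in `alg`; here `r` is the resolvent
`(T + z)⁻¹`. -/
def HasCompactResolvent (T : H →ₗ.[ℂ] H) (alg : StarSubalgebra ℂ (H →L[ℂ] H)) : Prop :=
  ∀ z ∈ ({Complex.I, -Complex.I} : Set ℂ), ∃ r : H →L[ℂ] H,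
    (∀ ξ, ∃ hξ : r ξ ∈ T.domain, T ⟨r ξ, hξ⟩ + z • r ξ = ξ) ∧
      ∀ a ∈ alg, IsCompactOperator (a ∘L r)

/-- The `C²`-condition: there is a core `C` for `T²` such that every `a` in `alg` maps `C` into
`Dom T²` and `[T², a] (T ± i)⁻¹`, defined on `(T ± i) C`, is bounded. -/
def IsC2 (T : H →ₗ.[ℂ] H) (alg : StarSubalgebra ℂ (H →L[ℂ] H)) : Prop :=
  ∃ C : Submodule ℂ H, (sqPMap T).HasCore C ∧ ∀ a ∈ alg,
    ∃ κ : ℝ, ∀ (ξ : H) (hξ : ξ ∈ (sqPMap T).domain), ξ ∈ C →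
      ∃ haξ : a ξ ∈ (sqPMap T).domain, ∀ z ∈ ({Complex.I, -Complex.I} : Set ℂ),
        ‖sqPMap T ⟨a ξ, haξ⟩ - a (sqPMap T ⟨ξ, hξ⟩)‖ ≤
          κ * ‖T ⟨ξ, sqPMap_domain_le T hξ⟩ + z • ξ‖

variable (H) in
/-- A `ℤ/2`-graded unital spectral triple, given by a unital `*`-algebra of even bounded operators
on `H`, the grading `Γ` and the odd self-adjoint operator `D`, satisfying the `C²`-condition. -/
structure C2SpectralTriple where
  alg : StarSubalgebra ℂ (H →L[ℂ] H)
  Γ : H →L[ℂ] H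
  Γ_sq : Γ ∘L Γ = .id ℂ H
  Γ_selfAdjoint : IsSelfAdjoint Γ
  D : H →ₗ.[ℂ] H
  selfAdjoint : IsSelfAdjoint D
  D_odd : IsOddOp D Γ
  alg_even : ∀ a ∈ alg, a ∘L Γ = Γ ∘L a
  compact : HasCompactResolvent D alg
  comm : ∀ a ∈ alg, ∃ c, IsCommutator D a c
  c2 : IsC2 D alg

variable (H) in
/-- The Hilbert space `H ⊕ H`. -/
abbrev Dbl : Type _ := WithLp 2 (H × H)

variable (H) in
/-- First coordinate `H ⊕ H → H`. -/
def dFst : Dbl H →L[ℂ] H := WithLp.fstL 2 ℂ H H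

variable (H) in
/-- Second coordinate `H ⊕ H → H`. -/
def dSnd : Dbl H →L[ℂ] H := WithLp.sndL 2 ℂ H H

variable (H) in
/-- First summand `H → H ⊕ H`. -/
def dInl : H →L[ℂ] Dbl H :=
  (WithLp.prodContinuousLinearEquiv 2 ℂ H H).symm.toContinuousLinearMap ∘L
    ContinuousLinearMap.inl ℂ H H

variable (H) in
/-- Second summand `H → H ⊕ H`. -/
def dInr : H →L[ℂ] Dbl H :=
  (WithLp.prodContinuousLinearEquiv 2 ℂ H H).symm.toContinuousLinearMap ∘L
    ContinuousLinearMap.inr ℂ H H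

/-- The operator matrix `(a 0; c d)` on `H ⊕ H`. -/
def block (a c d : H →L[ℂ] H) : Dbl H →L[ℂ] Dbl H :=
  dInl H ∘L a ∘L dFst H + dInr H ∘L (c ∘L dFst H + d ∘L dSnd H)

theorem block_apply (a c d : H →L[ℂ] H) (x : Dbl H) :
    block a c d x = WithLp.toLp 2 (a x.fst, c x.fst + d x.snd) := by
  apply (WithLp.prodContinuousLinearEquiv 2 ℂ H H).injective
  simp [block, dInl, dInr, dFst, dSnd]

theorem block_add (a c d a' c' d' : H →L[ℂ] H) :
    block a c d + block a' c' d' = block (a + a') (c + c') (d + d') := by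
  ext1 x
  apply (WithLp.prodContinuousLinearEquiv 2 ℂ H H).injective
  simp only [add_apply, block_apply, map_add]
  ext
  · simp
  · simp
    abel

theorem block_mul (a c d a' c' d' : H →L[ℂ] H) :
    block a c d * block a' c' d' = block (a * a') (c * a' + d * c') (d * d') := by
  ext1 x
  apply (WithLp.prodContinuousLinearEquiv 2 ℂ H H).injective
  simp only [ContinuousLinearMap.mul_def, ContinuousLinearMap.comp_apply, block_apply]
  ext
  · simp
  · simp
    abel

theorem block_algebraMap (r : ℂ) :
    block (algebraMap ℂ (H →L[ℂ] H) r) 0 (algebraMap ℂ (H →L[ℂ] H) r) =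
      algebraMap ℂ (Dbl H →L[ℂ] Dbl H) r := by
  ext1 x
  apply (WithLp.prodContinuousLinearEquiv 2 ℂ H H).injective
  ext <;> simp [block_apply, Algebra.algebraMap_eq_smul_one]

/-- `M = π¹(a) = (a 0; [D, a] a)`. -/
def IsPi1 (D : H →ₗ.[ℂ] H) (a : H →L[ℂ] H) (M : Dbl H →L[ℂ] Dbl H) : Prop :=
  ∃ c, IsCommutator D a c ∧ M = block a c a

/-- `M = π²(a) = ((D + i) a (D + i)⁻¹ 0; [D², a] (D + i)⁻¹ a)`. -/
def IsPi2 (D : H →ₗ.[ℂ] H) (a : H →L[ℂ] H) (M : Dbl H →L[ℂ] Dbl H) : Prop :=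
  ∃ e f : H →L[ℂ] H,
    (∀ (h : H) (hh : h ∈ D.domain), ∃ hah : a h ∈ D.domain,
      e (D ⟨h, hh⟩ + Complex.I • h) = D ⟨a h, hah⟩ + Complex.I • a h) ∧
    (∀ (h : H) (hh : h ∈ (sqPMap D).domain), ∃ hah : a h ∈ (sqPMap D).domain,
      f (D ⟨h, sqPMap_domain_le D hh⟩ + Complex.I • h) =
        sqPMap D ⟨a h, hah⟩ - a (sqPMap D ⟨h, hh⟩)) ∧
    M = block e f a

theorem isPi1_algebraMap (D : H →ₗ.[ℂ] H) (r : ℂ) :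
    IsPi1 D (algebraMap ℂ _ r) (algebraMap ℂ _ r) := by
  refine ⟨0, fun h hh => ⟨?_, ?_⟩, (block_algebraMap r).symm⟩
  · simpa [Algebra.algebraMap_eq_smul_one] using D.domain.smul_mem r hh
  · have := D.map_smul r ⟨h, hh⟩
    simp only [Algebra.algebraMap_eq_smul_one]
    exact (sub_eq_zero.2 this).symm

theorem IsPi1.add {D : H →ₗ.[ℂ] H} {a b : H →L[ℂ] H} {M N : Dbl H →L[ℂ] Dbl H}
    (ha : IsPi1 D a M) (hb : IsPi1 D b N) : IsPi1 D (a + b) (M + N) := by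
  obtain ⟨c, hc, rfl⟩ := ha
  obtain ⟨d, hd, rfl⟩ := hb
  refine ⟨c + d, fun h hh => ?_, block_add ..⟩
  obtain ⟨h1, e1⟩ := hc h hh
  obtain ⟨h2, e2⟩ := hd h hh
  refine ⟨D.domain.add_mem h1 h2, ?_⟩
  have := D.map_add ⟨_, h1⟩ ⟨_, h2⟩
  simp only [add_apply, e1, e2]
  refine Eq.trans ?_ (congrArg (· - _) this.symm)
  abel

theorem IsPi1.mul {D : H →ₗ.[ℂ] H} {a b : H →L[ℂ] H} {M N : Dbl H →L[ℂ] Dbl H}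
    (ha : IsPi1 D a M) (hb : IsPi1 D b N) : IsPi1 D (a * b) (M * N) := by
  obtain ⟨c, hc, rfl⟩ := ha
  obtain ⟨d, hd, rfl⟩ := hb
  refine ⟨c * b + a * d, fun h hh => ?_, block_mul ..⟩
  obtain ⟨h2, e2⟩ := hd h hh
  obtain ⟨h1, e1⟩ := hc (b h) h2
  refine ⟨h1, ?_⟩
  change c (b h) + a (d h) = D ⟨a (b h), h1⟩ - a (b (D ⟨h, hh⟩))
  rw [e1, e2, map_sub]
  abel

theorem isPi2_algebraMap (D : H →ₗ.[ℂ] H) (r : ℂ) :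
    IsPi2 D (algebraMap ℂ _ r) (algebraMap ℂ _ r) := by
  refine ⟨algebraMap ℂ _ r, 0, fun h hh => ⟨?_, ?_⟩, fun h hh => ⟨?_, ?_⟩,
    (block_algebraMap r).symm⟩
  · simpa [Algebra.algebraMap_eq_smul_one] using D.domain.smul_mem r hh
  · have := D.map_smul r ⟨h, hh⟩
    simp only [Algebra.algebraMap_eq_smul_one]
    refine Eq.trans ?_ (congrArg (· + _) this.symm)
    simp [smul_comm r Complex.I]
  · simpa [Algebra.algebraMap_eq_smul_one] using (sqPMap D).domain.smul_mem r hh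
  · have := (sqPMap D).map_smul r ⟨h, hh⟩
    simp only [Algebra.algebraMap_eq_smul_one]
    exact (sub_eq_zero.2 this).symm

theorem IsPi2.add {D : H →ₗ.[ℂ] H} {a b : H →L[ℂ] H} {M N : Dbl H →L[ℂ] Dbl H}
    (ha : IsPi2 D a M) (hb : IsPi2 D b N) : IsPi2 D (a + b) (M + N) := by
  obtain ⟨e, f, he, hf, rfl⟩ := ha
  obtain ⟨e', f', he', hf', rfl⟩ := hb
  refine ⟨e + e', f + f', fun h hh => ?_, fun h hh => ?_, block_add ..⟩
  · obtain ⟨h1, e1⟩ := he h hh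
    obtain ⟨h2, e2⟩ := he' h hh
    refine ⟨D.domain.add_mem h1 h2, ?_⟩
    have := D.map_add ⟨_, h1⟩ ⟨_, h2⟩
    rw [add_apply, e1, e2]
    refine Eq.trans ?_ (congrArg (· + _) this.symm)
    simp only [add_apply, smul_add]
    abel
  · obtain ⟨h1, e1⟩ := hf h hh
    obtain ⟨h2, e2⟩ := hf' h hh
    refine ⟨(sqPMap D).domain.add_mem h1 h2, ?_⟩
    have := (sqPMap D).map_add ⟨_, h1⟩ ⟨_, h2⟩
    rw [add_apply, e1, e2]
    refine Eq.trans ?_ (congrArg (· - _) this.symm)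
    simp only [add_apply]
    abel

theorem IsPi2.mul {D : H →ₗ.[ℂ] H} {a b : H →L[ℂ] H} {M N : Dbl H →L[ℂ] Dbl H}
    (ha : IsPi2 D a M) (hb : IsPi2 D b N) : IsPi2 D (a * b) (M * N) := by
  obtain ⟨e, f, he, hf, rfl⟩ := ha
  obtain ⟨e', f', he', hf', rfl⟩ := hb
  refine ⟨e * e', f * e' + a * f', fun h hh => ?_, fun h hh => ?_, block_mul ..⟩
  · obtain ⟨h2, e2⟩ := he' h hh
    obtain ⟨h1, e1⟩ := he _ h2
    exact ⟨h1, (congrArg e e2).trans e1⟩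
  · obtain ⟨h2, e2⟩ := hf' h hh
    obtain ⟨h3, e3⟩ := he' h (sqPMap_domain_le D hh)
    obtain ⟨h1, e1⟩ := hf _ h2
    refine ⟨h1, ?_⟩
    have e4 := (congrArg f e3).trans e1
    have e5 := congrArg a e2
    rw [map_sub] at e5
    refine (congrArg₂ (· + ·) e4 e5).trans ?_
    exact sub_add_sub_cancel _ _ _

namespace C2SpectralTriple

variable (S : C2SpectralTriple H)

/-- The image of the algebra under `π¹`. -/
def pi1Alg : Subalgebra ℂ (Dbl H →L[ℂ] Dbl H) where
  carrier := {M | ∃ a ∈ S.alg, IsPi1 S.D a M}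
  mul_mem' := by
    rintro _ _ ⟨a, ha, hM⟩ ⟨b, hb, hN⟩
    exact ⟨_, mul_mem ha hb, hM.mul hN⟩
  add_mem' := by
    rintro _ _ ⟨a, ha, hM⟩ ⟨b, hb, hN⟩
    exact ⟨_, add_mem ha hb, hM.add hN⟩
  algebraMap_mem' r := ⟨_, S.alg.algebraMap_mem r, isPi1_algebraMap _ r⟩

variable (H) in
/-- The `C*`-algebra `𝔹(H ⊕ H) ⊕ 𝔹(H ⊕ H) ⊕ 𝔹(H ⊕ H)`. -/
abbrev Ambient : Type _ :=
  (Dbl H →L[ℂ] Dbl H) × (Dbl H →L[ℂ] Dbl H) × (Dbl H →L[ℂ] Dbl H)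

/-- The image of the algebra under `a ↦ π¹(a) ⊕ π²(a) ⊕ π²(a*)*`. -/
def pi2Alg : Subalgebra ℂ (Ambient H) where
  carrier := {M | ∃ a ∈ S.alg, IsPi1 S.D a M.1 ∧ IsPi2 S.D a M.2.1 ∧
    IsPi2 S.D (star a) (star M.2.2)}
  mul_mem' := by
    rintro _ _ ⟨a, ha, hM, hM', hM''⟩ ⟨b, hb, hN, hN', hN''⟩
    refine ⟨_, mul_mem ha hb, hM.mul hN, hM'.mul hN', ?_⟩
    rw [star_mul]
    change IsPi2 S.D _ (star (_ * _))
    rw [star_mul]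
    exact hN''.mul hM''
  add_mem' := by
    rintro M N ⟨a, ha, hM, hM', hM''⟩ ⟨b, hb, hN, hN', hN''⟩
    refine ⟨_, add_mem ha hb, hM.add hN, hM'.add hN', ?_⟩
    have e : star (M + N).2.2 = star M.2.2 + star N.2.2 :=
      map_add ContinuousLinearMap.adjoint M.2.2 N.2.2
    rw [star_add, e]
    exact hM''.add hN''
  algebraMap_mem' r := by
    refine ⟨_, S.alg.algebraMap_mem r, isPi1_algebraMap _ r, isPi2_algebraMap _ r, ?_⟩
    rw [← algebraMap_star_comm]
    change IsPi2 S.D _ (star (algebraMap ℂ (Dbl H →L[ℂ] Dbl H) r))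
    rw [← algebraMap_star_comm]
    exact isPi2_algebraMap _ _

/-- The closure of the image of the algebra in the norm `‖π¹(·)‖`. -/
def B1sub : Subalgebra ℂ (Dbl H →L[ℂ] Dbl H) := S.pi1Alg.topologicalClosure

/-- The closure of the image of the algebra in the norm
`max {‖π¹(a)‖, ‖π²(a)‖, ‖π²(a*)‖}`. -/
def B2sub : Subalgebra ℂ (Ambient H) := S.pi2Alg.topologicalClosure

/-- The operator algebra `B₁`. -/
def B1 : Type _ := S.B1sub

/-- The operator algebra `B₂`. -/
def B2 : Type _ := S.B2sub

instance : NormedRing S.B1 := inferInstanceAs (NormedRing S.B1sub)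

instance : NormedAlgebra ℂ S.B1 := inferInstanceAs (NormedAlgebra ℂ S.B1sub)

instance : NormedRing S.B2 := inferInstanceAs (NormedRing S.B2sub)

instance : NormedAlgebra ℂ S.B2 := inferInstanceAs (NormedAlgebra ℂ S.B2sub)

/-- The representation of `B₁` on `H ⊕ H`. -/
def j1 : S.B1 →ₐ[ℂ] (Dbl H →L[ℂ] Dbl H) := S.B1sub.val

/-- The representation of `B₂` by triples of operators on `H ⊕ H`. -/
def j2 : S.B2 →ₐ[ℂ] Ambient H := S.B2sub.val

theorem j1_injective : Function.Injective S.j1 := Subtype.val_injective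

theorem continuous_j1 : Continuous S.j1 := continuous_subtype_val

/-- The inclusion `B₂ → B₁`. -/
def incl : S.B2 →ₐ[ℂ] S.B1 where
  toFun b := (⟨(S.j2 b).1, map_mem_closure continuous_fst b.2 (by
    rintro _ ⟨a, ha, h, -⟩
    exact ⟨a, ha, h⟩)⟩ : S.B1sub)
  map_one' := rfl
  map_mul' _ _ := rfl
  map_zero' := rfl
  map_add' _ _ := rfl
  commutes' _ := rfl

theorem j1_incl (b : S.B2) : S.j1 (S.incl b) = (S.j2 b).1 := rfl

/-- The representation of `B₁` on `H`, i.e. the inclusion `B₁ ⊆ B ⊆ 𝔹(H)`. -/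
def rho : S.B1 →ₗ[ℂ] (H →L[ℂ] H) where
  toFun a := dFst H ∘L S.j1 a ∘L dInl H
  map_add' a b := by ext; simp
  map_smul' c a := by ext; simp

/-- The derivation `a ↦ [D, a]` on `B₁`. -/
def dD : S.B1 →ₗ[ℂ] (H →L[ℂ] H) where
  toFun a := dSnd H ∘L S.j1 a ∘L dInl H
  map_add' a b := by ext; simp
  map_smul' c a := by ext; simp

theorem B1_upper (a : S.B1) : dFst H ∘L S.j1 a ∘L dInr H = 0 := by
  have hcl : IsClosed {M : Dbl H →L[ℂ] Dbl H | dFst H ∘L M ∘L dInr H = 0} := by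
    refine isClosed_eq ?_ continuous_const
    fun_prop
  refine closure_minimal ?_ hcl a.2
  rintro _ ⟨a, -, c, -, rfl⟩
  ext x
  change (block a c a (dInr H x)).fst = 0
  simp [block_apply, dInr]

theorem fst_apply (a : S.B1) (z : Dbl H) : dFst H (S.j1 a z) = S.rho a (dFst H z) := by
  have e : z = dInl H (dFst H z) + dInr H (dSnd H z) := by
    apply (WithLp.prodContinuousLinearEquiv 2 ℂ H H).injective
    ext <;> simp [dInl, dInr, dFst, dSnd]
  have h := DFunLike.congr_fun (S.B1_upper a) (dSnd H z)
  change dFst H (S.j1 a (dInr H (dSnd H z))) = 0 at h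
  conv_lhs => rw [e, map_add, map_add, h, add_zero]
  rfl

theorem rho_mul (a b : S.B1) : S.rho (a * b) = S.rho a * S.rho b := by
  ext h
  change dFst H (S.j1 (a * b) _) = _
  rw [map_mul]
  exact S.fst_apply a (S.j1 b (dInl H h))

/-! #### Universal one-forms -/

/-- The multiplication map `B₁ ⊗ʰ B₂ → B₁ ⊆ 𝔹(H ⊕ H)`. -/
def mulMap : Haag S.j1 S.j2 →L[ℂ] (Dbl H →L[ℂ] Dbl H) :=
  haagSandwich (StarAlgHom.id ℂ _) (StarAlgHom.fst ℂ _ _) (.id ℂ _) (.id ℂ _) (.id ℂ _)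

theorem mulMap_tmul (a : S.B1) (b : S.B2) :
    S.mulMap (haagOf _ _ (a ⊗ₜ b)) = S.j1 (a * S.incl b) := by
  rw [mulMap, haagSandwich_tmul]
  rfl

/-- Universal one-forms `Ω¹ᵤ(B₁, B₂) = ker (m : B₁ ⊗ʰ B₂ → B₁)`. -/
def Omega : Type _ := LinearMap.ker S.mulMap.toLinearMap

instance : AddCommGroup S.Omega :=
  inferInstanceAs (AddCommGroup (LinearMap.ker S.mulMap.toLinearMap))

instance : Module ℂ S.Omega :=
  inferInstanceAs (Module ℂ (LinearMap.ker S.mulMap.toLinearMap))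

/-- The inclusion `Ω¹ᵤ(B₁, B₂) ⊆ B₁ ⊗ʰ B₂`. -/
def omegaVal : S.Omega →ₗ[ℂ] Haag S.j1 S.j2 :=
  (LinearMap.ker S.mulMap.toLinearMap).subtype

theorem omegaVal_injective : Function.Injective S.omegaVal := Subtype.val_injective

theorem mulMap_omegaVal (ω : S.Omega) : S.mulMap (S.omegaVal ω) = 0 := ω.2

/-- The continuous linear map on `B₁ ⊗ʰ B₂` with `a ⊗ b ↦ a [D, b]`. -/
def piHaag : Haag S.j1 S.j2 →L[ℂ] (H →L[ℂ] H) :=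
  haagSandwich (StarAlgHom.id ℂ _) (StarAlgHom.fst ℂ _ _) (dFst H) (dInl H ∘L dSnd H) (dInl H)

theorem piHaag_tmul (a : S.B1) (b : S.B2) :
    S.piHaag (haagOf _ _ (a ⊗ₜ b)) = S.rho a * S.dD (S.incl b) := by
  rw [piHaag, haagSandwich_tmul]
  rfl

/-- `[D², b] (D + i)⁻¹` for `b` in `B₂`. -/
def dD2 : S.B2 →ₗ[ℂ] (H →L[ℂ] H) where
  toFun b := dSnd H ∘L (S.j2 b).2.1 ∘L dInl H
  map_add' a b := by ext; simp
  map_smul' c a := by ext; simp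

/-- The continuous linear map on `B₁ ⊗ʰ B₂` with `a ⊗ b ↦ a [D², b] (D + i)⁻¹`. -/
def piSqHaag : Haag S.j1 S.j2 →L[ℂ] (H →L[ℂ] H) :=
  haagSandwich (StarAlgHom.id ℂ _) ((StarAlgHom.fst ℂ _ _).comp (StarAlgHom.snd ℂ _ _))
    (dFst H) (dInl H ∘L dSnd H) (dInl H)

theorem piSqHaag_tmul (a : S.B1) (b : S.B2) :
    S.piSqHaag (haagOf _ _ (a ⊗ₜ b)) = S.rho a * S.dD2 b := by
  rw [piSqHaag, haagSandwich_tmul]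
  rfl

/-- The continuous linear map on `B₁ ⊗ʰ B₂` with `a ⊗ b ↦ [D, a] [D, b]`. -/
def piDeltaHaag : Haag S.j1 S.j2 →L[ℂ] (H →L[ℂ] H) :=
  haagSandwich (StarAlgHom.id ℂ _) (StarAlgHom.fst ℂ _ _) (dSnd H) (dInl H ∘L dSnd H) (dInl H)

theorem piDeltaHaag_tmul (a : S.B1) (b : S.B2) :
    S.piDeltaHaag (haagOf _ _ (a ⊗ₜ b)) = S.dD a * S.dD (S.incl b) := by
  rw [piDeltaHaag, haagSandwich_tmul]
  rfl

/-- The representation `π_D : Ω¹ᵤ(B₁, B₂) → 𝔹(H)`, `a δ(b) ↦ a [D, b]`. -/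
def piD : S.Omega →ₗ[ℂ] (H →L[ℂ] H) := S.piHaag.toLinearMap ∘ₗ S.omegaVal

/-- The representation `π_{D²} : Ω¹ᵤ(B₁, B₂) → 𝔹(Dom D, H)`, `a δ(b) ↦ a [D², b]`. -/
def piDsq : S.Omega →ₗ[ℂ] (S.D.domain →ₗ[ℂ] H) :=
  LinearMap.mk₂ ℂ (fun ω h => S.piSqHaag (S.omegaVal ω) (S.D h + Complex.I • (h : H)))
    (fun ω ω' h => by simp) (fun c ω h => by simp)
    (fun ω h h' => by
      rw [S.D.map_add, ← map_add]
      congr 1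
      simp only [Submodule.coe_add, smul_add]
      abel)
    (fun c ω h => by
      rw [S.D.map_smul, ← map_smul]
      congr 1
      simp [smul_comm c Complex.I])

/-- The represented differential `π_D ∘ δ : Ω¹ᵤ(B₁, B₂) → Ω²_D ⊆ 𝔹(H)`, where
`δ(a δ(b)) = δ(a) δ(b)` and `π_D(δ(a) δ(b)) = [D, a] [D, b]`. -/
def piDdelta : S.Omega →ₗ[ℂ] (H →L[ℂ] H) := S.piDeltaHaag.toLinearMap ∘ₗ S.omegaVal

/-- The universal derivation `δ(b) = 1 ⊗ b - b ⊗ 1` on `B₂`. -/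
def delta : S.B2 →ₗ[ℂ] S.Omega :=
  LinearMap.codRestrict (LinearMap.ker S.mulMap.toLinearMap)
    (haagOf S.j1 S.j2 ∘ₗ (TensorProduct.mk ℂ S.B1 S.B2 1 -
      (TensorProduct.mk ℂ S.B1 S.B2).flip 1 ∘ₗ S.incl.toLinearMap))
    (fun b => by
      change S.mulMap (haagOf S.j1 S.j2 (1 ⊗ₜ b - S.incl b ⊗ₜ 1)) = 0
      rw [map_sub, map_sub, mulMap_tmul, mulMap_tmul]
      simp)

theorem mulMap_lmul (a : S.B1) (z : Haag S.j1 S.j2) :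
    S.mulMap (haagLmul a z) = S.j1 a * S.mulMap z := by
  have h : S.mulMap ∘L haagLmul a = ContinuousLinearMap.mul ℂ _ (S.j1 a) ∘L S.mulMap := by
    refine haag_ext fun b c => ?_
    simp only [ContinuousLinearMap.comp_apply, haagLmul_tmul, mulMap_tmul,
      ContinuousLinearMap.mul_apply', map_mul, mul_assoc]
  exact DFunLike.congr_fun h z

theorem mulMap_rmul (b : S.B2) (z : Haag S.j1 S.j2) :
    S.mulMap (haagRmul b z) = S.mulMap z * S.j1 (S.incl b) := by
  have h : S.mulMap ∘L haagRmul b =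
      (ContinuousLinearMap.mul ℂ _).flip (S.j1 (S.incl b)) ∘L S.mulMap := by
    refine haag_ext fun a c => ?_
    rw [ContinuousLinearMap.comp_apply, haagRmul_tmul, mulMap_tmul,
      ContinuousLinearMap.comp_apply, mulMap_tmul, map_mul S.incl, ← mul_assoc]
    exact map_mul S.j1 _ _
  exact DFunLike.congr_fun h z

/-- The left action of `B₁` on `Ω¹ᵤ(B₁, B₂)`. -/
def lact : S.B1 →ₗ[ℂ] S.Omega →ₗ[ℂ] S.Omega :=
  LinearMap.mk₂ ℂ (fun a ω => (⟨haagLmul a (S.omegaVal ω), by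
      change S.mulMap _ = 0
      rw [mulMap_lmul, mulMap_omegaVal, mul_zero]⟩ : LinearMap.ker S.mulMap.toLinearMap))
    (fun a a' ω => S.omegaVal_injective (by
      change haagLmul (a + a') (S.omegaVal ω) = haagLmul a _ + haagLmul a' _
      rw [haagLmul_add]; rfl))
    (fun c a ω => S.omegaVal_injective (by
      change haagLmul (c • a) (S.omegaVal ω) = c • haagLmul a _
      rw [haagLmul_smul]; rfl))
    (fun a ω ω' => S.omegaVal_injective (map_add (haagLmul a) (S.omegaVal ω) (S.omegaVal ω')))
    (fun c a ω => S.omegaVal_injective (map_smul (haagLmul a) c (S.omegaVal ω)))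

/-- The right action of `B₂` on `Ω¹ᵤ(B₁, B₂)`. -/
def ract (b : S.B2) : S.Omega →ₗ[ℂ] S.Omega :=
  LinearMap.codRestrict (LinearMap.ker S.mulMap.toLinearMap)
    ((haagRmul b).toLinearMap ∘ₗ S.omegaVal) (fun z => by
      change S.mulMap (haagRmul b (S.omegaVal z)) = 0
      rw [mulMap_rmul, mulMap_omegaVal, zero_mul])

theorem lact_mul (a a' : S.B1) (ω : S.Omega) : S.lact (a * a') ω = S.lact a (S.lact a' ω) :=
  S.omegaVal_injective (haagLmul_mul a a' (S.omegaVal ω))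

theorem lact_ract (a : S.B1) (b : S.B2) (ω : S.Omega) :
    S.lact a (S.ract b ω) = S.ract b (S.lact a ω) :=
  S.omegaVal_injective (haagLmul_rmul a b (S.omegaVal ω))

theorem piD_lact (a : S.B1) (ω : S.Omega) : S.piD (S.lact a ω) = S.rho a * S.piD ω := by
  have h : S.piHaag ∘L haagLmul a = ContinuousLinearMap.mul ℂ _ (S.rho a) ∘L S.piHaag := by
    refine haag_ext fun b c => ?_
    simp only [ContinuousLinearMap.comp_apply, haagLmul_tmul, piHaag_tmul,
      ContinuousLinearMap.mul_apply', rho_mul, mul_assoc]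
  exact DFunLike.congr_fun h (S.omegaVal ω)

theorem piDsq_lact (a : S.B1) (ω : S.Omega) (h : S.D.domain) :
    S.piDsq (S.lact a ω) h = S.rho a (S.piDsq ω h) := by
  have h' : S.piSqHaag ∘L haagLmul a = ContinuousLinearMap.mul ℂ _ (S.rho a) ∘L S.piSqHaag := by
    refine haag_ext fun b c => ?_
    simp only [ContinuousLinearMap.comp_apply, haagLmul_tmul, piSqHaag_tmul,
      ContinuousLinearMap.mul_apply', rho_mul, mul_assoc]
  exact DFunLike.congr_fun (DFunLike.congr_fun h' (S.omegaVal ω)) _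

end C2SpectralTriple

end Triple

/-! ### Balanced tensor products -/

section Balanced

variable {A M Q P : Type*} [AddCommGroup M] [Module ℂ M] [AddCommGroup Q] [Module ℂ Q]
  [AddCommGroup P] [Module ℂ P]

/-- The algebraic balanced tensor product `M ⊗_A Q` of a right `A`-module `M` and a left
`A`-module `Q`: the quotient of `M ⊗ Q` by the span of the `m a ⊗ q - m ⊗ a q`. -/
abbrev BalTensor (r : A → M →ₗ[ℂ] M) (l : A → Q →ₗ[ℂ] Q) : Type _ :=
  (M ⊗[ℂ] Q) ⧸ Submodule.span ℂ
    (Set.range fun t : A × M × Q => r t.1 t.2.1 ⊗ₜ[ℂ] t.2.2 - t.2.1 ⊗ₜ[ℂ] l t.1 t.2.2)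

variable {r : A → M →ₗ[ℂ] M} {l : A → Q →ₗ[ℂ] Q}

/-- The elementary tensor. -/
def BalTensor.mk (r : A → M →ₗ[ℂ] M) (l : A → Q →ₗ[ℂ] Q) :
    M →ₗ[ℂ] Q →ₗ[ℂ] BalTensor r l :=
  (TensorProduct.mk ℂ M Q).compr₂ (Submodule.mkQ _)

theorem BalTensor.mk_balanced (a : A) (m : M) (q : Q) :
    BalTensor.mk r l (r a m) q = BalTensor.mk r l m (l a q) :=
  (Submodule.Quotient.eq _).2 (Submodule.subset_span ⟨(a, m, q), rfl⟩)

/-- The linear map on `M ⊗_A Q` induced by a balanced bilinear map. -/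
def BalTensor.lift (f : M →ₗ[ℂ] Q →ₗ[ℂ] P) (hf : ∀ a m q, f (r a m) q = f m (l a q)) :
    BalTensor r l →ₗ[ℂ] P :=
  Submodule.liftQ _ (TensorProduct.lift f) (by
    rw [Submodule.span_le]
    rintro _ ⟨⟨a, m, q⟩, rfl⟩
    change TensorProduct.lift f _ = 0
    rw [map_sub, TensorProduct.lift.tmul, TensorProduct.lift.tmul, hf, sub_self])

theorem BalTensor.lift_mk (f : M →ₗ[ℂ] Q →ₗ[ℂ] P) (hf : ∀ a m q, f (r a m) q = f m (l a q))
    (m : M) (q : Q) : BalTensor.lift f hf (BalTensor.mk r l m q) = f m q :=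
  TensorProduct.lift.tmul _ _

end Balanced

/-! ### Finitely generated projective modules -/

section Modules

variable {H : Type*} [NormedAddCommGroup H] [InnerProductSpace ℂ H] [CompleteSpace H]

/-- The index set of the standard basis of `B^{2N}`: `N` even and `N` odd vectors. -/
abbrev Idx (N : ℕ) : Type := Fin N ⊕ Fin N

/-- The sign of a basis vector. -/
def sgn {N : ℕ} : Idx N → ℂ := Sum.elim (fun _ => 1) (fun _ => -1)

/-- A `ℤ/2`-graded inner product module `X` over `B₂` which is finitely generated and projective,
in the sense that it comes with an even, inner product preserving isomorphism `v` onto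
`p B₂^{2N}`, where `p` is a projection. -/
structure FGPModule (S : C2SpectralTriple H) (N : ℕ) (X : Type*) [AddCommGroup X] [Module ℂ X]
    [Module S.B2ᵐᵒᵖ X] where
  γ : X →ₗ[S.B2ᵐᵒᵖ] X
  γ_γ : ∀ x, γ (γ x) = x
  inner : X → X → S.B2
  v : X →ₗ[S.B2ᵐᵒᵖ] (Idx N → S.B2)
  p : Matrix (Idx N) (Idx N) S.B2
  v_injective : Function.Injective v
  v_even : ∀ x i, v (γ x) i = sgn i • v x i
  v_inner : ∀ x y, S.rho (S.incl (inner x y)) =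
    ∑ i, star (S.rho (S.incl (v x i))) * S.rho (S.incl (v y i))
  p_idem : p * p = p
  p_selfAdjoint : ∀ i j, star (S.rho (S.incl (p i j))) = S.rho (S.incl (p j i))
  range_v : ∀ y, y ∈ LinearMap.range v ↔ p.mulVec y = y

namespace FGPModule

variable {S : C2SpectralTriple H} {N : ℕ} {X : Type*} [AddCommGroup X] [Module ℂ X]
  [Module S.B2ᵐᵒᵖ X] [IsScalarTower ℂ S.B2ᵐᵒᵖ X] (M : FGPModule S N X)

/-- The adjoint `v* : B₂^{2N} → X`, `v* y = v⁻¹ (p y)`. -/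
def vStar (y : Idx N → S.B2) : X :=
  ((M.range_v (M.p.mulVec y)).2 (by rw [Matrix.mulVec_mulVec, M.p_idem])).choose

theorem v_vStar (y : Idx N → S.B2) : M.v (M.vStar y) = M.p.mulVec y :=
  ((M.range_v (M.p.mulVec y)).2 (by rw [Matrix.mulVec_mulVec, M.p_idem])).choose_spec

/-- The frame `xᵢ = v*(eᵢ)`. -/
def frame (i : Idx N) : X := M.vStar (Pi.single i 1)

/-- The map `v` viewed as a map to `B₁^{2N}`. -/
def vB1 : X →ₗ[ℂ] (Idx N → S.B1) where
  toFun x i := S.incl (M.v x i)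
  map_add' x y := by ext i; simp
  map_smul' c x := by
    have h : M.v (c • x) = c • M.v x := LinearMap.map_smul_of_tower M.v c x
    ext i
    simp [h]

/-- The closed right `B₁`-submodule of `B₁^{2N}` generated by `v(X)`. As `v(X)` is a `B₂`-module
and `B₂` is dense in `B₁`, this is the closure of `v(X)`. -/
def Xvsub : Submodule ℂ (Idx N → S.B1) :=
  (Submodule.span ℂ
    (Set.range fun t : X × S.B1 => fun i => M.vB1 t.1 i * t.2)).topologicalClosure

/-- The completion `X_v` of `X` in the norm `‖v(x)‖_{B₁^{2N}}`, realised in `B₁^{2N}`. -/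
def Xv : Type _ := M.Xvsub

instance : AddCommGroup M.Xv := inferInstanceAs (AddCommGroup M.Xvsub)

instance : Module ℂ M.Xv := inferInstanceAs (Module ℂ M.Xvsub)

/-- The inclusion `X_v ⊆ B₁^{2N}`. -/
def XvVal : M.Xv →ₗ[ℂ] (Idx N → S.B1) := M.Xvsub.subtype

theorem XvVal_injective : Function.Injective M.XvVal := Subtype.val_injective

theorem vB1_mul_mem (x : X) (a : S.B1) : (fun i => M.vB1 x i * a) ∈ M.Xvsub :=
  Submodule.le_topologicalClosure _ (Submodule.subset_span ⟨(x, a), rfl⟩)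

/-- The inclusion `X → X_v`. -/
def toXv : X →ₗ[ℂ] M.Xv :=
  LinearMap.codRestrict M.Xvsub M.vB1 (fun x => by simpa using M.vB1_mul_mem x 1)

theorem XvVal_toXv (x : X) : M.XvVal (M.toXv x) = M.vB1 x := rfl

theorem Xv_map_mem {E : Type*} [AddCommGroup E] [Module ℂ E] [TopologicalSpace E]
    {T : (Idx N → S.B1) →ₗ[ℂ] E} (hT : Continuous T) {V : Submodule ℂ E}
    (hV : IsClosed (V : Set E)) (h : ∀ x a, T (fun i => M.vB1 x i * a) ∈ V) (y : M.Xv) :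
    T (M.XvVal y) ∈ V := by
  have hcl : IsClosed ((V.comap T : Submodule ℂ _) : Set (Idx N → S.B1)) := hV.preimage hT
  refine (Submodule.topologicalClosure_minimal _ ?_ hcl : M.Xvsub ≤ V.comap T) y.2
  rw [Submodule.span_le]
  rintro _ ⟨⟨x, a⟩, rfl⟩
  exact h x a

/-- The linear endomorphism of `X_v` induced by one of `B₁^{2N}`. -/
def XvMap (T : (Idx N → S.B1) →ₗ[ℂ] (Idx N → S.B1)) (hT : Continuous T)
    (h : ∀ x a, T (fun i => M.vB1 x i * a) ∈ M.Xvsub) : M.Xv →ₗ[ℂ] M.Xv :=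
  LinearMap.codRestrict M.Xvsub (T ∘ₗ M.XvVal)
    (M.Xv_map_mem hT (Submodule.isClosed_topologicalClosure _) h)

/-- The right action of `B₁` on `X_v`. -/
def XvRmul (a : S.B1) : M.Xv →ₗ[ℂ] M.Xv :=
  M.XvMap (LinearMap.pi fun i => LinearMap.mulRight ℂ a ∘ₗ LinearMap.proj i)
    (continuous_pi fun i => (continuous_apply i).mul continuous_const)
    (fun x b => by
      have := M.vB1_mul_mem x (b * a)
      simp only [← mul_assoc] at this
      exact this)

/-- The grading `γ` on `X_v`. -/
def XvGamma : M.Xv →ₗ[ℂ] M.Xv :=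
  M.XvMap (LinearMap.pi fun i => sgn i • LinearMap.proj i)
    (continuous_pi fun i => (continuous_apply i).const_smul (sgn i))
    (fun x b => by
      have := M.vB1_mul_mem (M.γ x) b
      convert this using 2 with i
      simp [vB1, M.v_even])

theorem XvVal_XvRmul (a : S.B1) (y : M.Xv) (i : Idx N) :
    M.XvVal (M.XvRmul a y) i = M.XvVal y i * a := rfl

theorem XvVal_XvGamma (y : M.Xv) (i : Idx N) :
    M.XvVal (M.XvGamma y) i = sgn i • M.XvVal y i := rfl

theorem XvGamma_toXv (x : X) : M.XvGamma (M.toXv x) = M.toXv (M.γ x) :=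
  M.XvVal_injective (funext fun i => by simp [XvVal_XvGamma, XvVal_toXv, vB1, M.v_even])

/-- The `i`-th coordinate `⟨xᵢ, y⟩` of `y` in `X_v ⊆ B₁^{2N}`. -/
def XvCoord (i : Idx N) : M.Xv →ₗ[ℂ] S.B1 := LinearMap.proj i ∘ₗ M.XvVal

/-! #### The Hilbert space `X ⊗_B H` -/

/-- The Hilbert space `H^{2N}`. -/
abbrev HN (H : Type*) [NormedAddCommGroup H] [InnerProductSpace ℂ H] (N : ℕ) : Type _ :=
  PiLp 2 fun _ : Idx N => H

/-- `y ⊗ h ↦ (yᵢ h)ᵢ`, as a map `B₁^{2N} → 𝔹(H, H^{2N})`. -/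
def stdTens : (Idx N → S.B1) →ₗ[ℂ] (H →L[ℂ] HN H N) where
  toFun y := (PiLp.continuousLinearEquiv 2 ℂ fun _ : Idx N => H).symm.toContinuousLinearMap ∘L
    ContinuousLinearMap.pi fun i => S.rho (y i)
  map_add' y z := by ext h i; simp
  map_smul' c y := by ext h i; simp

theorem stdTens_apply (y : Idx N → S.B1) (h : H) (i : Idx N) :
    stdTens y h i = S.rho (y i) h := rfl

/-- The closed span of the `v(x) h` in `H^{2N}`. -/
def XHsub : Submodule ℂ (HN H N) :=
  (Submodule.span ℂ
    (Set.range fun t : X × H => stdTens (M.vB1 t.1) t.2)).topologicalClosure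

/-- The interior tensor product `X ⊗_B H`, i.e. the completion of the algebraic tensor product in
the inner product `⟨x ⊗ h, y ⊗ k⟩ = ⟨h, ⟨x, y⟩ k⟩`, realised as a closed subspace of `H^{2N}`
through the isometry `x ⊗ h ↦ v(x) h`. -/
def XH : Type _ := M.XHsub

instance : NormedAddCommGroup M.XH := inferInstanceAs (NormedAddCommGroup M.XHsub)

instance : InnerProductSpace ℂ M.XH := inferInstanceAs (InnerProductSpace ℂ M.XHsub)

instance : CompleteSpace M.XH :=
  inferInstanceAs (CompleteSpace (Submodule.topologicalClosure _))

/-- The isometry `v : X ⊗_B H → H^{2N}`. -/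
def vH : M.XH →L[ℂ] HN H N := M.XHsub.subtypeL

theorem vH_injective : Function.Injective M.vH := Subtype.val_injective

theorem stdTens_mem (y : M.Xv) (h : H) : stdTens (M.XvVal y) h ∈ M.XHsub := by
  let T : (Idx N → S.B1) →ₗ[ℂ] HN H N := (LinearMap.applyₗ h) ∘ₗ
    ContinuousLinearMap.coeLM ℂ ∘ₗ stdTens
  have hT : Continuous T := by
    refine (PiLp.continuous_toLp 2 _).comp (continuous_pi fun i => ?_)
    change Continuous fun y : Idx N → S.B1 => dFst H (S.j1 (y i) (dInl H h))
    have h1 : Continuous fun y : Idx N → S.B1 => S.j1 (y i) :=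
      S.continuous_j1.comp (continuous_apply i)
    fun_prop
  refine M.Xv_map_mem hT (Submodule.isClosed_topologicalClosure _) (fun x a => ?_) y
  refine Submodule.le_topologicalClosure _ (Submodule.subset_span ⟨(x, S.rho a h), ?_⟩)
  refine (WithLp.equiv 2 _).injective (funext fun i => ?_)
  change S.rho (M.vB1 x i) (S.rho a h) = S.rho (M.vB1 x i * a) h
  rw [S.rho_mul]
  rfl

/-- `y ⊗ h` in `X ⊗_B H`, for `y` in `X_v` and `h` in `H`. -/
def tens : M.Xv →ₗ[ℂ] (H →L[ℂ] M.XH) where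
  toFun y := (stdTens (M.XvVal y)).codRestrict M.XHsub (M.stdTens_mem y)
  map_add' y z := by
    ext1 h
    refine M.vH_injective ?_
    change stdTens (M.XvVal (y + z)) h = stdTens (M.XvVal y) h + stdTens (M.XvVal z) h
    simp
  map_smul' c y := by
    ext1 h
    refine M.vH_injective ?_
    change stdTens (M.XvVal (c • y)) h = c • stdTens (M.XvVal y) h
    simp

theorem vH_tens (y : M.Xv) (h : H) (i : Idx N) :
    M.vH (M.tens y h) i = S.rho (M.XvVal y i) h := rfl

theorem tens_rmul (a : S.B1) (y : M.Xv) : M.tens (M.XvRmul a y) = M.tens y ∘L S.rho a := by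
  ext1 h
  refine M.vH_injective ((WithLp.equiv 2 _).injective (funext fun i => ?_))
  change S.rho (M.XvVal y i * a) h = S.rho (M.XvVal y i) (S.rho a h)
  rw [S.rho_mul]
  rfl

/-- `x ⊗ h` in `X ⊗_B H`, for `x` in `X`. -/
def xTens (x : X) (h : H) : M.XH := M.tens (M.toXv x) h

theorem inner_xTens (x y : X) (h k : H) :
    ⟪M.xTens x h, M.xTens y k⟫_ℂ = ⟪h, S.rho (S.incl (M.inner x y)) k⟫_ℂ := by
  rw [M.v_inner]
  change ⟪stdTens (M.vB1 x) h, stdTens (M.vB1 y) k⟫_ℂ = _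
  rw [PiLp.inner_apply]
  simp only [stdTens_apply, sum_apply, inner_sum, mul_apply_eq_comp,
    ContinuousLinearMap.star_eq_adjoint, ContinuousLinearMap.adjoint_inner_right]
  rfl

/-! #### Connections -/

/-- `X_v ⊗_{B₁} Ω¹ᵤ(B₁, B₂)`, the algebraic balanced tensor product. -/
def Forms : Type _ := BalTensor M.XvRmul fun a => S.lact a

instance : AddCommGroup M.Forms :=
  inferInstanceAs (AddCommGroup (BalTensor M.XvRmul fun a => S.lact a))

instance : Module ℂ M.Forms :=
  inferInstanceAs (Module ℂ (BalTensor M.XvRmul fun a => S.lact a))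

/-- The elementary tensor `y ⊗ ω`. -/
def formTmul : M.Xv →ₗ[ℂ] S.Omega →ₗ[ℂ] M.Forms := BalTensor.mk M.XvRmul fun a => S.lact a

theorem formTmul_balanced (a : S.B1) (y : M.Xv) (ω : S.Omega) :
    M.formTmul (M.XvRmul a y) ω = M.formTmul y (S.lact a ω) :=
  BalTensor.mk_balanced a y ω

/-- The linear map on `X_v ⊗_{B₁} Ω¹ᵤ(B₁, B₂)` induced by a balanced bilinear map. -/
def formsLift {P : Type*} [AddCommGroup P] [Module ℂ P] (f : M.Xv →ₗ[ℂ] S.Omega →ₗ[ℂ] P)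
    (hf : ∀ a y ω, f (M.XvRmul a y) ω = f y (S.lact a ω)) : M.Forms →ₗ[ℂ] P :=
  BalTensor.lift f hf

theorem formsLift_tmul {P : Type*} [AddCommGroup P] [Module ℂ P]
    (f : M.Xv →ₗ[ℂ] S.Omega →ₗ[ℂ] P) (hf : ∀ a y ω, f (M.XvRmul a y) ω = f y (S.lact a ω))
    (y : M.Xv) (ω : S.Omega) : M.formsLift f hf (M.formTmul y ω) = f y ω :=
  BalTensor.lift_mk f hf y ω

/-- The right action of `B₂` on `X_v ⊗_{B₁} Ω¹ᵤ(B₁, B₂)`. -/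
def formsRmul (b : S.B2) : M.Forms →ₗ[ℂ] M.Forms :=
  M.formsLift (M.formTmul.compl₂ (S.ract b)) (fun a y ω => by
    simp only [LinearMap.compl₂_apply]
    rw [← S.lact_ract]
    exact M.formTmul_balanced a y (S.ract b ω))

/-- `γ ⊗ 1` on `X_v ⊗_{B₁} Ω¹ᵤ(B₁, B₂)`. -/
def formsGamma : M.Forms →ₗ[ℂ] M.Forms :=
  M.formsLift (M.formTmul ∘ₗ M.XvGamma) (fun a y ω => by
    have e : M.XvGamma (M.XvRmul a y) = M.XvRmul a (M.XvGamma y) :=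
      M.XvVal_injective (funext fun i => by simp [XvVal_XvGamma, XvVal_XvRmul])
    simp only [LinearMap.comp_apply, e]
    exact M.formTmul_balanced a (M.XvGamma y) ω)

/-- `1 ⊗ π_D`: the form `y ⊗ ω` acts as `h ↦ y ⊗ π_D(ω) h`. -/
def formsPiD : M.Forms →ₗ[ℂ] (H →L[ℂ] M.XH) :=
  M.formsLift
    (LinearMap.mk₂ ℂ (fun y ω => M.tens y ∘L S.piD ω) (fun y y' ω => by ext1; simp)
      (fun c y ω => by ext1; simp) (fun y ω ω' => by ext1; simp) (fun c y ω => by ext1; simp))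
    (fun a y ω => by
      simp only [LinearMap.mk₂_apply, S.piD_lact, tens_rmul]
      rfl)

/-- `1 ⊗ π_{D²}`: the form `y ⊗ ω` acts as `h ↦ y ⊗ π_{D²}(ω) h`, for `h` in `Dom D`. -/
def formsPiDsq : M.Forms →ₗ[ℂ] (S.D.domain →ₗ[ℂ] M.XH) :=
  M.formsLift
    (LinearMap.mk₂ ℂ (fun y ω => (M.tens y).toLinearMap ∘ₗ S.piDsq ω)
      (fun y y' ω => by ext1; simp)
      (fun c y ω => by ext1; simp) (fun y ω ω' => by ext1; simp) (fun c y ω => by ext1; simp))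
    (fun a y ω => by
      ext1 h
      simp only [LinearMap.mk₂_apply, LinearMap.comp_apply, S.piDsq_lact, tens_rmul]
      rfl)

/-- The `i`-th coordinate `⟨xᵢ, y⟩ ω` of `v (y ⊗ ω)` in
`B₁^{2N} ⊗_{B₁} Ω¹ᵤ(B₁, B₂) = Ω¹ᵤ(B₁, B₂)^{2N}`. -/
def formsCoord (i : Idx N) : M.Forms →ₗ[ℂ] S.Omega :=
  M.formsLift (S.lact ∘ₗ M.XvCoord i) (fun a y ω => S.lact_mul (M.XvVal y i) a ω)

/-- A `C²`-connection `∇ : X → X_v ⊗_{B₁} Ω¹ᵤ(B₁, B₂)`: a linear map which respects the grading and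
satisfies the Leibniz rule `∇(x b) = ∇(x) b + γ(x) ⊗ δ(b)`. -/
structure C2Connection where
  toFun : X →ₗ[ℂ] M.Forms
  even : ∀ x, toFun (M.γ x) = M.formsGamma (toFun x)
  leibniz : ∀ (x : X) (b : S.B2), toFun (MulOpposite.op b • x) =
    M.formsRmul b (toFun x) + M.formTmul (M.toXv (M.γ x)) (S.delta b)

/-- The Grassmann connection `∇ᵛ(x) = ∑ᵢ γ(xᵢ) ⊗ δ(⟨xᵢ, x⟩)`. -/
def grassmann (x : X) : M.Forms :=
  ∑ i, M.formTmul (M.toXv (M.γ (M.frame i))) (S.delta (M.inner (M.frame i) x))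

/-! #### Operators on `H^{2N}` -/

/-- The operator on `H^{2N}` with a given matrix of bounded operators. -/
def matOp (m : Matrix (Idx N) (Idx N) (H →L[ℂ] H)) : HN H N →L[ℂ] HN H N :=
  (PiLp.continuousLinearEquiv 2 ℂ fun _ : Idx N => H).symm.toContinuousLinearMap ∘L
    ContinuousLinearMap.pi fun i => ∑ j, m i j ∘L PiLp.proj 2 (fun _ : Idx N => H) j

/-- The projection `p` as an operator on `H^{2N}`. -/
def pOp : HN H N →L[ℂ] HN H N := matOp (M.p.map fun b => S.rho (S.incl b))

/-- The operator `γ ⊗ D` on `H^{2N}`, with domain `(Dom D)^{2N}`. -/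
def stdD (S : C2SpectralTriple H) (N : ℕ) : HN H N →ₗ.[ℂ] HN H N where
  domain :=
    { carrier := {ξ | ∀ i, ξ i ∈ S.D.domain}
      add_mem' := fun hx hy i => S.D.domain.add_mem (hx i) (hy i)
      zero_mem' := fun _ => S.D.domain.zero_mem
      smul_mem' := fun c _ hx i => S.D.domain.smul_mem c (hx i) }
  toFun :=
    { toFun := fun ξ => WithLp.toLp 2 fun i => sgn i • S.D ⟨ξ.1 i, ξ.2 i⟩
      map_add' := fun x y => by
        refine (WithLp.equiv 2 _).injective (funext fun i => ?_)
        have := S.D.map_add ⟨x.1 i, x.2 i⟩ ⟨y.1 i, y.2 i⟩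
        exact (congrArg (sgn i • ·) this).trans (smul_add _ _ _)
      map_smul' := fun c x => by
        refine (WithLp.equiv 2 _).injective (funext fun i => ?_)
        have := S.D.map_smul c ⟨x.1 i, x.2 i⟩
        exact (congrArg (sgn i • ·) this).trans (smul_comm _ _ _) }

namespace C2Connection

variable {M} (nab : M.C2Connection)

/-- The represented connection `∇_D(x) h = (1 ⊗ π_D)(∇(x)) h`. -/
def nablaD (x : X) (h : H) : M.XH := M.formsPiD (nab.toFun x) h

/-- `(γ ⊗ π_{D²})(∇(x)) h`, for `h` in `Dom D`. -/
def nablaDsq (x : X) (h : S.D.domain) : M.XH :=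
  M.formsPiDsq (M.formsGamma (nab.toFun x)) h

/-- The operator `1 ⊗_∇ D : x ⊗ h ↦ γ(x) ⊗ D h + ∇_D(x) h` on the span of the `x ⊗ h` with `x` in
`X` and `h` in `Dom D`, given by its graph. -/
def oneTensD : M.XH →ₗ.[ℂ] M.XH :=
  (Submodule.span ℂ (Set.range fun t : X × S.D.domain =>
    ((M.xTens t.1 t.2, M.xTens (M.γ t.1) (S.D t.2) + nab.nablaD t.1 t.2) :
      M.XH × M.XH))).toLinearPMap

/-- The operator `1 ⊗_∇ D² : x ⊗ h ↦ x ⊗ D² h + (γ ⊗ π_{D²})(∇(x)) h` on the span of the `x ⊗ h`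
with `x` in `X` and `h` in `Dom D²`, given by its graph. -/
def oneTensDsq : M.XH →ₗ.[ℂ] M.XH :=
  (Submodule.span ℂ (Set.range fun t : X × (sqPMap S.D).domain =>
    ((M.xTens t.1 t.2, M.xTens t.1 (sqPMap S.D t.2) +
      nab.nablaDsq t.1 ⟨t.2, sqPMap_domain_le S.D t.2.2⟩) : M.XH × M.XH))).toLinearPMap

/-- The curvature operator `R = (1 ⊗_∇ D)² - 1 ⊗_∇ D²`. -/
def curvature : M.XH →ₗ.[ℂ] M.XH := sqPMap nab.oneTensD - nab.oneTensDsq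

/-- The connection form `ω = ∇ - ∇ᵛ`. -/
def omega (x : X) : M.Forms := nab.toFun x - M.grassmann x

/-- The matrix of `v ω v* : B₂^{2N} → Ω¹ᵤ(B₁, B₂)^{2N}`. -/
def omegaMatrix : Matrix (Idx N) (Idx N) S.Omega :=
  fun i j => M.formsCoord i (nab.omega (M.frame j))

/-- `π_D(δ(v ω v*))` as an operator on `H^{2N}`. The differential acts on
`B₁^{2N} ⊗_{B₁} Ω¹ᵤ(B₁, B₂)` by `e ⊗ η ↦ γ(e) ⊗ δ(η)`. -/
def piDdeltaOmega : HN H N →L[ℂ] HN H N :=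
  matOp fun i j => sgn i • S.piDdelta (nab.omegaMatrix i j)

end C2Connection

end FGPModule

end Modules

end Curv

end

noncomputable section

namespace Curv

/-! ### Graphs of partially defined operators. -/

section Graph

variable {E F : Type*} [AddCommGroup E] [Module ℂ E] [AddCommGroup F] [Module ℂ F]

/-! The isometry `v` carries everything to `H^{2N}`, where connections become matrices. With the
frame `xⱼ = v*(eⱼ)`, every `z` in `X ⊗_B H` equals `∑ xⱼ ⊗ (vz)ⱼ`. Writing `∇ = ∇ᵛ + ω`, the Leibniz
rule cancels the derivation terms in `ω`, so `ω` is `B₂`-linear and is the matrix `(ωᵢⱼ)`. The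
Grassmann part gives compressions of `D` and `D²`. Hence `1 ⊗_∇ D = v*(γ ⊗ D)v + ω_D` on the
preimage of `(Dom D)^{2N}`, and `1 ⊗_∇ D² = v*(1 ⊗ D²)v + (γ ⊗ π_{D²})(ω)` on the preimage of `(Dom
D²)^{2N}` (`oneTensD_eq`, `oneTensDsq_eq`). The right sides are honest operators, so the spans
defining the left sides are graphs; this is the well-definedness.

Squaring uses `v v* = p` and `v* v = 1` (`compD_compD`). From `pv = v` and `v*[D,p]p = 0` one gets
`v* D p D v = v* D² v + v*[D,p][D,p]v`. For the cross terms, `D a[D,b] = [D,a][D,b] + a[D²,b] -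
a[D,b]D` extends to all forms and gives `D(vω_D z) = π_D(δ(vωv*))vz + v(γ ⊗ π_{D²})(ω)z - vω_D v* D
vz` (`omegaD_mem_graph`). The last term cancels `ω_D v* D v z`, the middle one belongs to `1 ⊗_∇
D²`, and the bounded first one remains.

The analytic content is that these identities, clear for the original algebra, survive completion.
Each is phrased as membership in the graph of `D`, which is closed, so it passes to norm limits in
`B₁`, `B₂` and the Haagerup tensor product (`isPi1_rho`, `isPi2_rho`, `piHaag_mem_graph`). -/

theorem mem_graph_iff_exists {T : E →ₗ.[ℂ] F} {x : E} {y : F} :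
    (x, y) ∈ T.graph ↔ ∃ hx : x ∈ T.domain, T ⟨x, hx⟩ = y := by
  rw [LinearPMap.mem_graph_iff]
  constructor
  · rintro ⟨z, rfl, rfl⟩
    exact ⟨z.2, rfl⟩
  · rintro ⟨hx, rfl⟩
    exact ⟨⟨x, hx⟩, rfl, rfl⟩

/-- `1 ⊗_∇ D` and `1 ⊗_∇ D²` are defined from spans of pairs. Once such a span is recognised as the
graph of a known operator, this recovers the operator. -/
theorem toLinearPMap_graph_self (T : E →ₗ.[ℂ] F) : T.graph.toLinearPMap = T :=
  LinearPMap.eq_of_eq_graph (Submodule.toLinearPMap_graph_eq _ fun x hx h0 =>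
    LinearPMap.graph_fst_eq_zero_snd T (x := x.1) (x' := x.2) hx h0)

end Graph

/-! ### The representations `π¹` and `π²` as closed conditions. -/

section Blocks

variable {H : Type*} [NormedAddCommGroup H] [InnerProductSpace ℂ H] [CompleteSpace H]

theorem eq_block_iff {M : Dbl H →L[ℂ] Dbl H} {a c d : H →L[ℂ] H} :
    M = block a c d ↔ dFst H ∘L M ∘L dInl H = a ∧ dSnd H ∘L M ∘L dInl H = c ∧
      dFst H ∘L M ∘L dInr H = 0 ∧ dSnd H ∘L M ∘L dInr H = d := by
  constructor
  · rintro rfl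
    refine ⟨?_, ?_, ?_, ?_⟩ <;> ext x <;> simp [block_apply, dInl, dInr, dFst, dSnd]
  · rintro ⟨h1, h2, h3, h4⟩
    ext1 z
    have e : z = dInl H (dFst H z) + dInr H (dSnd H z) := by
      apply (WithLp.prodContinuousLinearEquiv 2 ℂ H H).injective
      ext <;> simp [dInl, dInr, dFst, dSnd]
    have h1 := DFunLike.congr_fun h1 (dFst H z)
    have h2 := DFunLike.congr_fun h2 (dFst H z)
    have h3 := DFunLike.congr_fun h3 (dSnd H z)
    have h4 := DFunLike.congr_fun h4 (dSnd H z)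
    have f1 : dFst H (M z) = a (dFst H z) := by
      conv_lhs => rw [e, map_add, map_add]
      exact (congrArg₂ (· + ·) h1 h3).trans (add_zero _)
    have f2 : dSnd H (M z) = c (dFst H z) + d (dSnd H z) := by
      conv_lhs => rw [e, map_add, map_add]
      exact congrArg₂ (· + ·) h2 h4
    rw [block_apply]
    apply (WithLp.prodContinuousLinearEquiv 2 ℂ H H).injective
    exact Prod.ext f1 f2

/-- The domain condition and the commutator formula merge into one membership in the graph of `D`,
which for each fixed `h` depends continuously on `(a, M)`. -/
theorem isPi1_iff {D : H →ₗ.[ℂ] H} {a : H →L[ℂ] H} {M : Dbl H →L[ℂ] Dbl H} :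
    IsPi1 D a M ↔ dFst H ∘L M ∘L dInl H = a ∧ dFst H ∘L M ∘L dInr H = 0 ∧
      dSnd H ∘L M ∘L dInr H = a ∧
      ∀ h : D.domain, (a h, (dSnd H ∘L M ∘L dInl H) h + a (D h)) ∈ D.graph := by
  constructor
  · rintro ⟨c, hc, hM⟩
    obtain ⟨h1, h2, h3, h4⟩ := eq_block_iff.1 hM
    refine ⟨h1, h3, h4, fun h => ?_⟩
    rw [h2]
    obtain ⟨hah, e⟩ := hc h h.2
    exact mem_graph_iff_exists.2 ⟨hah, by rw [e]; simp⟩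
  · rintro ⟨h1, h3, h4, h⟩
    refine ⟨_, fun x hx => ?_, eq_block_iff.2 ⟨h1, rfl, h3, h4⟩⟩
    obtain ⟨hax, e⟩ := mem_graph_iff_exists.1 (h ⟨x, hx⟩)
    exact ⟨hax, by rw [e]; simp⟩

/-- The third condition says `e(D + i)h - i a h = D a h`, where `e` is the upper left corner. The
fourth then says that this vector lies in `Dom D` and that `D` sends it to `[D², a]h + a D² h`. So
`D²` enters only through the graph of `D`. -/
theorem isPi2_iff {D : H →ₗ.[ℂ] H} {a : H →L[ℂ] H} {M : Dbl H →L[ℂ] Dbl H} :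
    IsPi2 D a M ↔ dFst H ∘L M ∘L dInr H = 0 ∧ dSnd H ∘L M ∘L dInr H = a ∧
      (∀ h : D.domain, (a h, (dFst H ∘L M ∘L dInl H) (D h + Complex.I • (h : H)) -
        Complex.I • a h) ∈ D.graph) ∧
      ∀ h : (sqPMap D).domain, ((dFst H ∘L M ∘L dInl H)
        (D ⟨h, sqPMap_domain_le D h.2⟩ + Complex.I • (h : H)) - Complex.I • a h,
        (dSnd H ∘L M ∘L dInl H) (D ⟨h, sqPMap_domain_le D h.2⟩ + Complex.I • (h : H)) +
          a (sqPMap D h)) ∈ D.graph := by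
  constructor
  · rintro ⟨e, f, he, hf, hM⟩
    obtain ⟨h1, h2, h3, h4⟩ := eq_block_iff.1 hM
    rw [h1, h2]
    refine ⟨h3, h4, fun h => ?_, fun h => ?_⟩
    · obtain ⟨hah, e1⟩ := he h h.2
      exact mem_graph_iff_exists.2 ⟨hah, by rw [e1]; simp⟩
    · obtain ⟨hah, e1⟩ := he h (sqPMap_domain_le D h.2)
      obtain ⟨hah', e2⟩ := hf h h.2
      rw [e1, e2, add_sub_cancel_right, sub_add_cancel, sqPMap_apply]
      exact LinearPMap.mem_graph D ⟨_, hah'.2⟩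
  · rintro ⟨h3, h4, he, hf⟩
    refine ⟨_, _, fun h hh => ?_, fun h hh => ?_, eq_block_iff.2 ⟨rfl, rfl, h3, h4⟩⟩
    · obtain ⟨hah, e⟩ := mem_graph_iff_exists.1 (he ⟨h, hh⟩)
      exact ⟨hah, by rw [e]; simp⟩
    · obtain ⟨hah, e⟩ := mem_graph_iff_exists.1 (he ⟨h, sqPMap_domain_le D hh⟩)
      obtain ⟨hah', e'⟩ := mem_graph_iff_exists.1 (hf ⟨h, hh⟩)
      refine ⟨⟨hah, by rw [e]; exact hah'⟩, ?_⟩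
      rw [sqPMap_apply]
      simp only [e, e', add_sub_cancel_right]

/-- An intersection of equalities of continuous maps and preimages of the closed graph of `D`. -/
theorem isClosed_isPi1 {D : H →ₗ.[ℂ] H} (hD : D.IsClosed) :
    IsClosed {q : (H →L[ℂ] H) × (Dbl H →L[ℂ] Dbl H) | IsPi1 D q.1 q.2} := by
  simp only [isPi1_iff, Set.ofPred_and, Set.ofPred_forall]
  refine (isClosed_eq (by fun_prop) (by fun_prop)).inter
    ((isClosed_eq (by fun_prop) (by fun_prop)).inter
      ((isClosed_eq (by fun_prop) (by fun_prop)).inter (isClosed_iInter fun h => ?_)))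
  exact IsClosed.preimage (f := fun q : (H →L[ℂ] H) × (Dbl H →L[ℂ] Dbl H) =>
    (q.1 h, (dSnd H ∘L q.2 ∘L dInl H) h + q.1 (D h))) (by fun_prop) hD

theorem isClosed_isPi2 {D : H →ₗ.[ℂ] H} (hD : D.IsClosed) :
    IsClosed {q : (H →L[ℂ] H) × (Dbl H →L[ℂ] Dbl H) | IsPi2 D q.1 q.2} := by
  simp only [isPi2_iff, Set.ofPred_and, Set.ofPred_forall]
  refine (isClosed_eq (by fun_prop) (by fun_prop)).inter
    ((isClosed_eq (by fun_prop) (by fun_prop)).inter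
      ((isClosed_iInter fun h => ?_).inter (isClosed_iInter fun h => ?_)))
  · exact IsClosed.preimage (f := fun q : (H →L[ℂ] H) × (Dbl H →L[ℂ] Dbl H) =>
      (q.1 h, (dFst H ∘L q.2 ∘L dInl H) (D h + Complex.I • (h : H)) - Complex.I • q.1 h))
      (by fun_prop) hD
  · exact IsClosed.preimage (f := fun q : (H →L[ℂ] H) × (Dbl H →L[ℂ] Dbl H) =>
      ((dFst H ∘L q.2 ∘L dInl H)
        (D ⟨h, sqPMap_domain_le D h.2⟩ + Complex.I • (h : H)) - Complex.I • q.1 h,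
        (dSnd H ∘L q.2 ∘L dInl H) (D ⟨h, sqPMap_domain_le D h.2⟩ + Complex.I • (h : H)) +
          q.1 (sqPMap D h))) (by fun_prop) hD

end Blocks

/-! ### Elements of `B₁` and `B₂` as operators on `H`. -/

namespace C2SpectralTriple

variable {H : Type*} [NormedAddCommGroup H] [InnerProductSpace ℂ H] [CompleteSpace H]
  (S : C2SpectralTriple H)

/-- The relation holds on the dense image of the algebra and is closed. -/
theorem isPi1_rho (a : S.B1) : IsPi1 S.D (S.rho a) (S.j1 a) := by
  have hc : Continuous fun M : Dbl H →L[ℂ] Dbl H => (dFst H ∘L M ∘L dInl H, M) := by fun_prop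
  refine closure_minimal ?_ ((isClosed_isPi1 S.selfAdjoint.isClosed).preimage hc) a.2
  rintro M ⟨a, -, hM⟩
  change IsPi1 S.D (dFst H ∘L M ∘L dInl H) M
  rwa [(isPi1_iff.1 hM).1]

theorem isCommutator_rho (a : S.B1) : IsCommutator S.D (S.rho a) (S.dD a) := by
  obtain ⟨c, hc, hM⟩ := S.isPi1_rho a
  have : S.dD a = c := (eq_block_iff.1 hM).2.1
  rwa [this]

theorem isPi2_rho (b : S.B2) : IsPi2 S.D (S.rho (S.incl b)) (S.j2 b).2.1 ∧
    IsPi2 S.D (star (S.rho (S.incl b))) (star (S.j2 b).2.2) := by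
  have hc : Continuous fun M : Ambient H => (dFst H ∘L M.1 ∘L dInl H, M.2.1) := by fun_prop
  have hc' : Continuous fun M : Ambient H =>
    (star (dFst H ∘L M.1 ∘L dInl H), star M.2.2) :=
    (ContinuousLinearMap.adjoint.continuous.comp (by fun_prop)).prodMk
      (ContinuousLinearMap.adjoint.continuous.comp (by fun_prop))
  refine closure_minimal ?_
    (((isClosed_isPi2 S.selfAdjoint.isClosed).preimage hc).inter
    ((isClosed_isPi2 S.selfAdjoint.isClosed).preimage hc')) b.2
  rintro M ⟨a, -, hM, hM', hM''⟩
  change IsPi2 S.D (dFst H ∘L M.1 ∘L dInl H) M.2.1 ∧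
    IsPi2 S.D (star (dFst H ∘L M.1 ∘L dInl H)) (star M.2.2)
  rw [(isPi1_iff.1 hM).1]
  exact ⟨hM', hM''⟩

/-- `(D + i) b (D + i)⁻¹` for `b` in `B₂`. -/
def conj2 (b : S.B2) : H →L[ℂ] H := dFst H ∘L (S.j2 b).2.1 ∘L dInl H

theorem conj2_apply (b : S.B2) (h : H) (hh : h ∈ S.D.domain) :
    ∃ hb : S.rho (S.incl b) h ∈ S.D.domain, S.conj2 b (S.D ⟨h, hh⟩ + Complex.I • h) =
      S.D ⟨S.rho (S.incl b) h, hb⟩ + Complex.I • S.rho (S.incl b) h := by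
  obtain ⟨e, f, he, hf, hM⟩ := (S.isPi2_rho b).1
  have : S.conj2 b = e := (eq_block_iff.1 hM).1
  rw [this]
  exact he h hh

theorem dD2_apply (b : S.B2) (h : H) (hh : h ∈ (sqPMap S.D).domain) :
    ∃ hb : S.rho (S.incl b) h ∈ (sqPMap S.D).domain,
      S.dD2 b (S.D ⟨h, sqPMap_domain_le S.D hh⟩ + Complex.I • h) =
        sqPMap S.D ⟨S.rho (S.incl b) h, hb⟩ - S.rho (S.incl b) (sqPMap S.D ⟨h, hh⟩) := by
  obtain ⟨e, f, he, hf, hM⟩ := (S.isPi2_rho b).1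
  have : S.dD2 b = f := (eq_block_iff.1 hM).2.1
  rw [this]
  exact hf h hh

theorem j2_block (b : S.B2) : (S.j2 b).2.1 = block (S.conj2 b) (S.dD2 b) (S.rho (S.incl b)) :=
  eq_block_iff.2 ⟨rfl, rfl, (isPi2_iff.1 (S.isPi2_rho b).1).1,
    (isPi2_iff.1 (S.isPi2_rho b).1).2.1⟩

theorem j1_block (a : S.B1) : S.j1 a = block (S.rho a) (S.dD a) (S.rho a) :=
  eq_block_iff.2 ⟨rfl, rfl, (isPi1_iff.1 (S.isPi1_rho a)).2.1,
    (isPi1_iff.1 (S.isPi1_rho a)).2.2.1⟩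

/-! #### The resolvent -/

theorem exists_resolvent : ∃ r : H →L[ℂ] H,
    ∀ ξ, ∃ hξ : r ξ ∈ S.D.domain, S.D ⟨r ξ, hξ⟩ + Complex.I • r ξ = ξ := by
  obtain ⟨r, hr, -⟩ := S.compact Complex.I (by simp)
  exact ⟨r, hr⟩

/-- If `Dh = -ih`, symmetry of `D` forces `i⟨h, h⟩ = -i⟨h, h⟩`. -/
theorem eq_zero_of_apply_add_I_smul (h : S.D.domain) (e : S.D h + Complex.I • (h : H) = 0) :
    (h : H) = 0 := by
  have hs : ⟪S.D h, (h : H)⟫_ℂ = ⟪(h : H), S.D h⟫_ℂ := by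
    have := LinearPMap.adjoint_isFormalAdjoint S.selfAdjoint.dense_domain
    rw [LinearPMap.isSelfAdjoint_def.1 S.selfAdjoint] at this
    exact this h h
  rw [eq_neg_of_add_eq_zero_left e, inner_neg_left, inner_neg_right, inner_smul_left,
    inner_smul_right, Complex.conj_I] at hs
  have h2 : Complex.I * ⟪(h : H), (h : H)⟫_ℂ = 0 := by linear_combination (1 / 2) * hs
  exact inner_self_eq_zero.1 ((mul_eq_zero.1 h2).resolve_left Complex.I_ne_zero)

/-- The resolvent is given as a right inverse of `D + i`; injectivity of `D + i` makes it a left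
inverse too. -/
theorem resolvent_apply {r : H →L[ℂ] H}
    (hr : ∀ ξ, ∃ hξ : r ξ ∈ S.D.domain, S.D ⟨r ξ, hξ⟩ + Complex.I • r ξ = ξ) (h : S.D.domain) :
    r (S.D h + Complex.I • (h : H)) = h := by
  obtain ⟨hd, e⟩ := hr (S.D h + Complex.I • (h : H))
  refine sub_eq_zero.1 (S.eq_zero_of_apply_add_I_smul (⟨_, hd⟩ - h) ?_)
  rw [S.D.map_sub, Submodule.coe_sub, smul_sub, sub_add_sub_comm, e, sub_self]

theorem resolvent_mem_sq {r : H →L[ℂ] H}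
    (hr : ∀ ξ, ∃ hξ : r ξ ∈ S.D.domain, S.D ⟨r ξ, hξ⟩ + Complex.I • r ξ = ξ) {h : H}
    (hh : h ∈ S.D.domain) : r h ∈ (sqPMap S.D).domain := by
  obtain ⟨hd, e⟩ := hr h
  refine ⟨hd, ?_⟩
  rw [eq_sub_of_add_eq e]
  exact S.D.domain.sub_mem hh (S.D.domain.smul_mem _ hd)

/-- The resolvent is continuous, has range `Dom D` and maps `Dom D` into `Dom D²`. As `Dom D` is
dense in `H`, its image is dense in `Dom D`. -/
theorem dense_sq_domain : Dense ((sqPMap S.D).domain : Set H) := by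
  obtain ⟨r, hr⟩ := S.exists_resolvent
  have h1 : (S.D.domain : Set H) ⊆ closure ((sqPMap S.D).domain : Set H) := by
    intro h hh
    have e := S.resolvent_apply hr ⟨h, hh⟩
    change _ = h at e
    rw [← e]
    refine map_mem_closure r.continuous
      (S.selfAdjoint.dense_domain (S.D ⟨h, hh⟩ + Complex.I • h)) fun x hx => ?_
    exact S.resolvent_mem_sq hr hx
  exact (S.selfAdjoint.dense_domain.mono h1).of_closure

/-! #### Uniqueness of the representations -/

theorem isPi1_zero {M : Dbl H →L[ℂ] Dbl H} (hM : IsPi1 S.D 0 M) : M = 0 := by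
  obtain ⟨c, hc, rfl⟩ := hM
  have : c = 0 := by
    refine DFunLike.coe_injective (Continuous.ext_on S.selfAdjoint.dense_domain c.continuous
      continuous_const fun h hh => ?_)
    obtain ⟨h0, e⟩ := hc h hh
    simp [e]
    exact S.D.map_zero
  subst this
  ext z : 1
  simp [block_apply]

/-- The upper corner is determined because `D + i` is onto. The lower corner is determined on `(D +
i) Dom D²`, which contains the dense subspace `Dom D`. -/
theorem isPi2_zero {M : Dbl H →L[ℂ] Dbl H} (hM : IsPi2 S.D 0 M) : M = 0 := by
  obtain ⟨e, f, he, hf, rfl⟩ := hM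
  obtain ⟨r, hr⟩ := S.exists_resolvent
  have e0 : e = 0 := by
    ext h
    obtain ⟨hd, e1⟩ := hr h
    obtain ⟨h0, e2⟩ := he _ hd
    rw [e1] at e2
    simp [e2]
    exact S.D.map_zero
  have f0 : f = 0 := by
    refine DFunLike.coe_injective (Continuous.ext_on S.selfAdjoint.dense_domain f.continuous
      continuous_const fun h hh => ?_)
    obtain ⟨hd, e1⟩ := hr h
    obtain ⟨h0, e2⟩ := hf _ (S.resolvent_mem_sq hr hh)
    rw [e1] at e2
    simp [e2]
    exact (sqPMap S.D).map_zero
  subst e0 f0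
  ext z : 1
  simp [block_apply]

/-- `B₂` is represented faithfully on `H`. -/
theorem rho_incl_injective : Function.Injective fun b : S.B2 => S.rho (S.incl b) := by
  have key : ∀ b : S.B2, S.rho (S.incl b) = 0 → b = 0 := by
    intro b hb
    have h1 := S.isPi1_rho (S.incl b)
    have h2 := S.isPi2_rho b
    rw [hb] at h1 h2
    rw [star_zero] at h2
    have h3 := S.isPi1_zero h1
    have h4 := S.isPi2_zero h2.1
    -- The third component of `b` is controlled through its adjoint, which is `π²` of the adjoint
    -- operator on `H`.
    have h5 := star_eq_zero.1 (S.isPi2_zero h2.2)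
    exact Subtype.val_injective (Prod.ext h3 (Prod.ext h4 h5))
  intro b c h
  refine sub_eq_zero.1 (key (b - c) ?_)
  rw [map_sub, map_sub]
  exact sub_eq_zero.2 h

/-! #### Representations of universal forms -/

/-- Elementary tensors span a dense subspace; this is the device for extending identities that
involve the unbounded `D`. -/
theorem haag_mem_of_tmul {V : Submodule ℂ (Haag S.j1 S.j2)} (hV : IsClosed (V : Set (Haag S.j1 S.j2)))
    (h : ∀ a b, haagOf S.j1 S.j2 (a ⊗ₜ b) ∈ V) (z : Haag S.j1 S.j2) : z ∈ V := by
  have h1 : ∀ w : S.B1 ⊗[ℂ] S.B2, haagOf S.j1 S.j2 w ∈ V := fun w => by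
    induction w using TensorProduct.induction_on with
    | zero => rw [map_zero]; exact V.zero_mem
    | tmul a b => exact h a b
    | add w w' hw hw' => rw [map_add]; exact V.add_mem hw hw'
  refine denseRange_haagEmb.induction_on z hV fun w => ?_
  exact h1 ((HaagAlg.of S.j1 S.j2).symm w)

/-- On `a ⊗ b` this is `D a[D,b] = [D,a][D,b] + a D[D,b]` together with `D[D,b] = [D²,b] - [D,b]D`
on `Dom D²`. For fixed `h` both coordinates are continuous in the tensor, so closedness of `D` gives
the general case. -/
theorem piHaag_mem_graph (h : (sqPMap S.D).domain) (z : Haag S.j1 S.j2) :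
    (S.piHaag z h, S.piDeltaHaag z h +
      S.piSqHaag z (S.D ⟨h, sqPMap_domain_le S.D h.2⟩ + Complex.I • (h : H)) -
      S.piHaag z (S.D ⟨h, sqPMap_domain_le S.D h.2⟩)) ∈ S.D.graph := by
  set k := S.D ⟨h, sqPMap_domain_le S.D h.2⟩ with hk
  let ev : H → (H →L[ℂ] H) →L[ℂ] H := fun x => ContinuousLinearMap.apply ℂ H x
  let L : Haag S.j1 S.j2 →L[ℂ] H × H := (ev h ∘L S.piHaag).prod
    (ev h ∘L S.piDeltaHaag + ev (k + Complex.I • (h : H)) ∘L S.piSqHaag - ev k ∘L S.piHaag)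
  refine S.haag_mem_of_tmul (V := S.D.graph.comap L.toLinearMap)
    (IsClosed.preimage L.continuous S.selfAdjoint.isClosed) (fun a b => ?_) z
  change (S.piHaag _ h, S.piDeltaHaag _ h + S.piSqHaag _ (k + Complex.I • (h : H)) -
    S.piHaag _ k) ∈ S.D.graph
  simp only [S.piHaag_tmul, S.piDeltaHaag_tmul, S.piSqHaag_tmul,
    ContinuousLinearMap.mul_def, ContinuousLinearMap.comp_apply]
  obtain ⟨hb, e1⟩ := S.dD2_apply b h h.2
  obtain ⟨hb1, e2⟩ := S.isCommutator_rho (S.incl b) h (sqPMap_domain_le S.D h.2)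
  obtain ⟨hb2, e3⟩ := S.isCommutator_rho (S.incl b) k h.2.2
  -- Both `D b h` and `b D h` lie in `Dom D`: the first because `b` preserves `Dom D²`, the second
  -- because it preserves `Dom D`.
  have hd : S.dD (S.incl b) h ∈ S.D.domain := by
    rw [e2]
    exact S.D.domain.sub_mem hb.2 hb2
  obtain ⟨ha, e4⟩ := S.isCommutator_rho a _ hd
  refine mem_graph_iff_exists.2 ⟨ha, ?_⟩
  have e5 : S.D ⟨_, hd⟩ = sqPMap S.D ⟨_, hb⟩ - S.D ⟨_, hb2⟩ := by
    rw [sqPMap_apply, ← S.D.map_sub]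
    exact congrArg S.D (Subtype.ext e2)
  rw [← hk] at e1
  rw [e1, e3, e4, ← add_sub_assoc', ← map_sub, e5]
  have e6 : S.D ⟨k, h.2.2⟩ = sqPMap S.D h := rfl
  rw [e6, ← sub_sub_sub_cancel_right]
  simp only [map_sub]
  abel

theorem piD_mem_graph (h : (sqPMap S.D).domain) (ω : S.Omega) :
    (S.piD ω h, S.piDdelta ω h + S.piDsq ω ⟨h, sqPMap_domain_le S.D h.2⟩ -
      S.piD ω (S.D ⟨h, sqPMap_domain_le S.D h.2⟩)) ∈ S.D.graph :=
  S.piHaag_mem_graph h (S.omegaVal ω)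

theorem dD_mul (a b : S.B1) : S.dD (a * b) = S.dD a * S.rho b + S.rho a * S.dD b := by
  have h : S.j1 (a * b) = S.j1 a * S.j1 b := map_mul _ _ _
  rw [S.j1_block a, S.j1_block b, block_mul] at h
  exact (eq_block_iff.1 h).2.1

theorem dD2_mul (a b : S.B2) :
    S.dD2 (a * b) = S.dD2 a * S.conj2 b + S.rho (S.incl a) * S.dD2 b := by
  have h : (S.j2 (a * b)).2.1 = (S.j2 a).2.1 * (S.j2 b).2.1 := by
    rw [map_mul]; rfl
  rw [S.j2_block a, S.j2_block b, block_mul] at h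
  exact (eq_block_iff.1 h).2.1

theorem rho_one : S.rho 1 = 1 := by
  ext h
  change dFst H (S.j1 1 _) = _
  rw [map_one]
  simp [dFst, dInl]

theorem dD_one : S.dD 1 = 0 := by
  ext h
  change dSnd H (S.j1 1 _) = _
  rw [map_one]
  simp [dSnd, dInl]

theorem dD2_one : S.dD2 1 = 0 := by
  ext h
  change dSnd H ((S.j2 1).2.1 _) = _
  rw [map_one]
  simp [dSnd, dInl]

/-- The Leibniz rule `[D, cb] = [D,c]b + c[D,b]` produces a second term that factors through
multiplication. It vanishes on `Ω¹ᵤ`, which makes `π_D` right `B₂`-linear. -/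
theorem piHaag_rmul (b : S.B2) (z : Haag S.j1 S.j2) :
    S.piHaag (haagRmul b z) = S.piHaag z * S.rho (S.incl b) +
      (dFst H ∘L S.mulMap z ∘L dInl H) * S.dD (S.incl b) := by
  let P : (Dbl H →L[ℂ] Dbl H) →L[ℂ] (H →L[ℂ] H) :=
    ContinuousLinearMap.compL ℂ H (Dbl H) H (dFst H) ∘L
      (ContinuousLinearMap.compL ℂ H (Dbl H) (Dbl H)).flip (dInl H)
  let R : (H →L[ℂ] H) → (H →L[ℂ] H) →L[ℂ] (H →L[ℂ] H) :=
    fun T => (ContinuousLinearMap.mul ℂ _).flip T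
  have h : S.piHaag ∘L haagRmul b = R (S.rho (S.incl b)) ∘L S.piHaag +
      R (S.dD (S.incl b)) ∘L P ∘L S.mulMap := by
    refine haag_ext fun a c => ?_
    change S.piHaag (haagRmul b _) = S.piHaag _ * S.rho (S.incl b) +
      (dFst H ∘L S.mulMap _ ∘L dInl H) * S.dD (S.incl b)
    rw [haagRmul_tmul, piHaag_tmul, piHaag_tmul, mulMap_tmul, map_mul, dD_mul]
    change _ = _ + S.rho _ * _
    rw [rho_mul]
    noncomm_ring
  exact DFunLike.congr_fun h z

/-- Here `b` is moved past `(D + i)⁻¹` and so appears as `(D + i)b(D + i)⁻¹`; the multiplication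
term again dies on `Ω¹ᵤ`. -/
theorem piSqHaag_rmul (b : S.B2) (z : Haag S.j1 S.j2) :
    S.piSqHaag (haagRmul b z) = S.piSqHaag z * S.conj2 b +
      (dFst H ∘L S.mulMap z ∘L dInl H) * S.dD2 b := by
  let P : (Dbl H →L[ℂ] Dbl H) →L[ℂ] (H →L[ℂ] H) :=
    ContinuousLinearMap.compL ℂ H (Dbl H) H (dFst H) ∘L
      (ContinuousLinearMap.compL ℂ H (Dbl H) (Dbl H)).flip (dInl H)
  let R : (H →L[ℂ] H) → (H →L[ℂ] H) →L[ℂ] (H →L[ℂ] H) :=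
    fun T => (ContinuousLinearMap.mul ℂ _).flip T
  have h : S.piSqHaag ∘L haagRmul b = R (S.conj2 b) ∘L S.piSqHaag +
      R (S.dD2 b) ∘L P ∘L S.mulMap := by
    refine haag_ext fun a c => ?_
    change S.piSqHaag (haagRmul b _) = S.piSqHaag _ * S.conj2 b +
      (dFst H ∘L S.mulMap _ ∘L dInl H) * S.dD2 b
    rw [haagRmul_tmul, piSqHaag_tmul, piSqHaag_tmul, mulMap_tmul, dD2_mul]
    change _ = _ + S.rho _ * _
    rw [rho_mul]
    noncomm_ring
  exact DFunLike.congr_fun h z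

theorem piD_ract (b : S.B2) (ω : S.Omega) :
    S.piD (S.ract b ω) = S.piD ω * S.rho (S.incl b) := by
  refine (S.piHaag_rmul b (S.omegaVal ω)).trans ?_
  rw [S.mulMap_omegaVal]
  simp
  rfl

theorem piDsq_ract (b : S.B2) (ω : S.Omega) (h : S.D.domain)
    (hb : S.rho (S.incl b) h ∈ S.D.domain) :
    S.piDsq (S.ract b ω) h = S.piDsq ω ⟨S.rho (S.incl b) h, hb⟩ := by
  obtain ⟨hb', e⟩ := S.conj2_apply b h h.2
  change S.piSqHaag (haagRmul b (S.omegaVal ω)) (S.D h + Complex.I • (h : H)) = _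
  rw [S.piSqHaag_rmul, S.mulMap_omegaVal]
  simp only [ContinuousLinearMap.zero_comp, ContinuousLinearMap.comp_zero, zero_mul, add_zero]
  exact congrArg (S.piSqHaag (S.omegaVal ω)) e

theorem omegaVal_delta (b : S.B2) : S.omegaVal (S.delta b) =
    haagOf S.j1 S.j2 (1 ⊗ₜ b) - haagOf S.j1 S.j2 (S.incl b ⊗ₜ 1) :=
  map_sub (haagOf S.j1 S.j2) (1 ⊗ₜ b) (S.incl b ⊗ₜ 1)

theorem piD_delta (b : S.B2) : S.piD (S.delta b) = S.dD (S.incl b) := by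
  change S.piHaag (S.omegaVal (S.delta b)) = _
  rw [omegaVal_delta, map_sub, piHaag_tmul, piHaag_tmul, map_one S.incl, dD_one, rho_one]
  simp

theorem piDsq_delta (b : S.B2) (h : S.D.domain) :
    S.piDsq (S.delta b) h = S.dD2 b (S.D h + Complex.I • (h : H)) := by
  change S.piSqHaag (S.omegaVal (S.delta b)) _ = _
  rw [omegaVal_delta, map_sub, piSqHaag_tmul, piSqHaag_tmul, dD2_one, rho_one]
  simp

/-- The Leibniz rule for the universal derivation. -/
theorem delta_mul (a b : S.B2) :
    S.delta (a * b) = S.ract b (S.delta a) + S.lact (S.incl a) (S.delta b) := by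
  refine S.omegaVal_injective ?_
  change S.omegaVal (S.delta (a * b)) =
    haagRmul b (S.omegaVal (S.delta a)) + haagLmul (S.incl a) (S.omegaVal (S.delta b))
  simp only [omegaVal_delta, map_sub, haagRmul_tmul, haagLmul_tmul, one_mul, mul_one, map_mul]
  abel

end C2SpectralTriple

end Curv

end

noncomputable section

namespace Curv

/-! ### Frames, the isometry `v` and forms in coordinates. -/

namespace FGPModule

variable {H : Type*} [NormedAddCommGroup H] [InnerProductSpace ℂ H] [CompleteSpace H]

theorem sgn_mul_self {N : ℕ} (i : Idx N) : sgn i * sgn i = 1 := by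
  rcases i with i | i <;> simp [sgn]

theorem sgn_smul_sgn_smul {N : ℕ} {E : Type*} [AddCommGroup E] [Module ℂ E] (i : Idx N) (x : E) :
    sgn i • sgn i • x = x := by
  rw [smul_smul, sgn_mul_self, one_smul]

theorem star_sgn {N : ℕ} (i : Idx N) : star (sgn i) = sgn i := by
  rcases i with i | i <;> simp [sgn]

theorem matOp_apply {N : ℕ} (m : Matrix (Idx N) (Idx N) (H →L[ℂ] H)) (ξ : HN H N) (i : Idx N) :
    matOp m ξ i = ∑ j, m i j (ξ j) := by
  simp [matOp]

variable {S : C2SpectralTriple H} {N : ℕ} {X : Type*} [AddCommGroup X] [Module ℂ X]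
  [Module S.B2ᵐᵒᵖ X] [IsScalarTower ℂ S.B2ᵐᵒᵖ X] (M : FGPModule S N X)

/-! #### The frame -/

theorem p_mulVec_v (x : X) : M.p.mulVec (M.v x) = M.v x := (M.range_v _).1 ⟨x, rfl⟩

theorem v_frame (i j : Idx N) : M.v (M.frame j) i = M.p i j := by
  rw [frame, v_vStar, Matrix.mulVec_single_one]
  rfl

theorem v_smul (c : ℂ) (x : X) : M.v (c • x) = c • M.v x :=
  LinearMap.map_smul_of_tower M.v c x

theorem v_op_smul (b : S.B2) (x : X) (i : Idx N) : M.v (MulOpposite.op b • x) i = M.v x i * b := by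
  rw [map_smul]
  rfl

/-- The sum for the inner product is `∑ (p_{ki})* v(x)ₖ = (p v(x))ᵢ = v(x)ᵢ`. The adjoints make
sense only in `𝔹(H)`, so equality in `B₂` needs its faithfulness on `H`. -/
theorem inner_frame (i : Idx N) (x : X) : M.inner (M.frame i) x = M.v x i := by
  refine S.rho_incl_injective ?_
  change S.rho (S.incl _) = S.rho (S.incl _)
  conv_rhs => rw [← M.p_mulVec_v x]
  simp only [M.v_inner, v_frame, M.p_selfAdjoint, Matrix.mulVec, dotProduct, map_sum, map_mul,
    S.rho_mul]

/-- Since `γ` preserves the range of `p`, one has `pγp = γp`; the adjoint identity is `pγp = pγ`, so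
`p` commutes with `γ`. -/
theorem p_even (i j : Idx N) : sgn i • M.p i j = sgn j • M.p i j := by
  -- The entries of `pγp = γp`, read off from `p v(γ(xⱼ)) = v(γ(xⱼ))`.
  have h1 : ∀ i j, ∑ k, sgn k • (S.rho (S.incl (M.p i k)) * S.rho (S.incl (M.p k j))) =
      sgn i • S.rho (S.incl (M.p i j)) := fun i j => by
    have h := congrFun (M.p_mulVec_v (M.γ (M.frame j))) i
    simp only [Matrix.mulVec, dotProduct, M.v_even, v_frame, mul_smul_comm] at h
    simpa only [map_sum, map_smul, map_mul, S.rho_mul] using congrArg (fun b => S.rho (S.incl b)) h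
  refine S.rho_incl_injective ?_
  simp only [map_smul]
  rw [← h1 i j]
  have h2 := congrArg star (h1 j i)
  simp only [star_sum, star_smul, star_sgn, star_mul, M.p_selfAdjoint] at h2
  exact h2

theorem gamma_frame (j : Idx N) : M.γ (M.frame j) = sgn j • M.frame j :=
  M.v_injective (funext fun i => by
    rw [M.v_even, v_smul, Pi.smul_apply, v_frame, M.p_even])

theorem sum_frame (x : X) : ∑ j, MulOpposite.op (M.v x j) • M.frame j = x :=
  M.v_injective (funext fun i => by
    rw [map_sum, Finset.sum_apply]
    simp only [v_op_smul, v_frame]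
    exact congrFun (M.p_mulVec_v x) i)

/-! #### The isometry `v` -/

theorem vH_xTens (x : X) (h : H) (i : Idx N) :
    M.vH (M.xTens x h) i = S.rho (S.incl (M.v x i)) h := rfl

theorem pOp_apply (ξ : HN H N) (i : Idx N) :
    M.pOp ξ i = ∑ j, S.rho (S.incl (M.p i j)) (ξ j) := matOp_apply _ _ _

theorem inner_pOp (ξ η : HN H N) : ⟪M.pOp ξ, η⟫_ℂ = ⟪ξ, M.pOp η⟫_ℂ := by
  simp only [PiLp.inner_apply, pOp_apply, sum_inner, inner_sum]
  rw [Finset.sum_comm]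
  refine Finset.sum_congr rfl fun i _ => Finset.sum_congr rfl fun j _ => ?_
  rw [← M.p_selfAdjoint, ContinuousLinearMap.star_eq_adjoint,
    ContinuousLinearMap.adjoint_inner_left]

theorem vH_sum_xTens_frame (ξ : HN H N) : M.vH (∑ j, M.xTens (M.frame j) (ξ j)) = M.pOp ξ := by
  ext i
  rw [map_sum, pOp_apply, WithLp.ofLp_sum, Finset.sum_apply]
  simp only [vH_xTens, v_frame]

/-- True on the generators `v(x)h` because `p v(x) = v(x)`, and a closed condition. -/
theorem pOp_vH (z : M.XH) : M.pOp (M.vH z) = M.vH z := by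
  have hcl : IsClosed ((LinearMap.eqLocus M.pOp.toLinearMap LinearMap.id : Submodule ℂ (HN H N)) :
      Set (HN H N)) := isClosed_eq M.pOp.continuous continuous_id
  refine (Submodule.topologicalClosure_minimal _ ?_ hcl :
    M.XHsub ≤ LinearMap.eqLocus M.pOp.toLinearMap LinearMap.id) z.2
  rw [Submodule.span_le]
  rintro _ ⟨⟨x, h⟩, rfl⟩
  change M.pOp (M.vH (M.xTens x h)) = M.vH (M.xTens x h)
  ext i
  rw [pOp_apply, vH_xTens, ← congrFun (M.p_mulVec_v x) i]
  simp only [vH_xTens, Matrix.mulVec, dotProduct, map_sum, map_mul, S.rho_mul, sum_apply,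
    mul_apply_eq_comp]

/-- The reconstruction formula `v* v = 1` in frame form. It reduces every statement on `X ⊗_B H` to
finitely many coordinates. -/
theorem sum_xTens_frame (z : M.XH) : ∑ j, M.xTens (M.frame j) (M.vH z j) = z :=
  M.vH_injective (by rw [vH_sum_xTens_frame, pOp_vH])

theorem adjoint_vH_apply (ξ : HN H N) :
    ContinuousLinearMap.adjoint M.vH ξ = ∑ j, M.xTens (M.frame j) (ξ j) := by
  refine ext_inner_left ℂ fun z => ?_
  rw [ContinuousLinearMap.adjoint_inner_right]
  change _ = ⟪M.vH z, M.vH (∑ j, M.xTens (M.frame j) (ξ j))⟫_ℂ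
  rw [vH_sum_xTens_frame, ← inner_pOp, pOp_vH]

theorem vH_adjoint_vH (ξ : HN H N) : M.vH (ContinuousLinearMap.adjoint M.vH ξ) = M.pOp ξ := by
  rw [adjoint_vH_apply, vH_sum_xTens_frame]

theorem adjoint_vH_vH (z : M.XH) : ContinuousLinearMap.adjoint M.vH (M.vH z) = z := by
  rw [adjoint_vH_apply, sum_xTens_frame]

theorem adjoint_vH_pOp (ξ : HN H N) :
    ContinuousLinearMap.adjoint M.vH (M.pOp ξ) = ContinuousLinearMap.adjoint M.vH ξ := by
  rw [← vH_adjoint_vH, adjoint_vH_vH]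

theorem pOp_pOp (ξ : HN H N) : M.pOp (M.pOp ξ) = M.pOp ξ := by
  rw [← M.vH_adjoint_vH ξ, pOp_vH]

/-! #### The operator `γ ⊗ D` -/

/-- The sign may stand on either side of `D ξᵢ = εᵢ ηᵢ` because `εᵢ² = 1`. -/
theorem mem_graph_stdD {ξ η : HN H N} :
    (ξ, η) ∈ (stdD S N).graph ↔ ∀ i, (ξ i, sgn i • η i) ∈ S.D.graph := by
  rw [mem_graph_iff_exists]
  constructor
  · rintro ⟨hξ, rfl⟩ i
    refine mem_graph_iff_exists.2 ⟨hξ i, ?_⟩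
    exact (sgn_smul_sgn_smul i _).symm
  · intro h
    refine ⟨fun i => (mem_graph_iff_exists.1 (h i)).1, ?_⟩
    ext i
    obtain ⟨h1, h2⟩ := mem_graph_iff_exists.1 (h i)
    change sgn i • S.D ⟨ξ i, _⟩ = η i
    rw [h2, sgn_smul_sgn_smul]

theorem stdD_apply (ξ : (stdD S N).domain) (i : Idx N) :
    stdD S N ξ i = sgn i • S.D ⟨ξ.1 i, ξ.2 i⟩ := rfl

theorem mem_sq_stdD_domain {ξ : HN H N} :
    ξ ∈ (sqPMap (stdD S N)).domain ↔ ∀ i, ξ i ∈ (sqPMap S.D).domain := by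
  constructor
  · rintro ⟨h, h'⟩ i
    refine ⟨h i, ?_⟩
    have := S.D.domain.smul_mem (sgn i) (h' i)
    rwa [stdD_apply, sgn_smul_sgn_smul] at this
  · intro h
    exact ⟨fun i => (h i).1, fun i => S.D.domain.smul_mem (sgn i) (h i).2⟩

theorem sq_stdD_apply (ξ : (sqPMap (stdD S N)).domain) (i : Idx N) :
    sqPMap (stdD S N) ξ i = sqPMap S.D ⟨ξ.1 i, mem_sq_stdD_domain.1 ξ.2 i⟩ := by
  rw [sqPMap_apply, stdD_apply, ← S.D.map_smul, sqPMap_apply]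
  congr 1
  exact Subtype.ext (sgn_smul_sgn_smul i _)

/-- The commutator `[γ ⊗ D, p]` on `H^{2N}`. -/
def commP : HN H N →L[ℂ] HN H N := matOp fun i j => sgn i • S.dD (S.incl (M.p i j))

theorem commP_apply (ξ : HN H N) (i : Idx N) :
    M.commP ξ i = ∑ j, sgn i • S.dD (S.incl (M.p i j)) (ξ j) := matOp_apply _ _ _

/-- Entrywise the commutator is `εᵢ D pᵢⱼ - pᵢⱼ εⱼ D`. Evenness of `p` replaces `εⱼ` by `εᵢ`,
leaving `εᵢ[D, pᵢⱼ]`, which is bounded. -/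
theorem isCommutator_commP : IsCommutator (stdD S N) M.pOp M.commP := by
  intro ξ hξ
  have key : ∀ i j, (S.rho (S.incl (M.p i j)) (ξ j), S.dD (S.incl (M.p i j)) (ξ j) +
      S.rho (S.incl (M.p i j)) (S.D ⟨ξ j, hξ j⟩)) ∈ S.D.graph := fun i j => by
    obtain ⟨h, e⟩ := S.isCommutator_rho (S.incl (M.p i j)) _ (hξ j)
    exact mem_graph_iff_exists.2 ⟨h, by rw [e, sub_add_cancel]⟩
  have hg : (M.pOp ξ, M.commP ξ + M.pOp (stdD S N ⟨ξ, hξ⟩)) ∈ (stdD S N).graph := by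
    refine mem_graph_stdD.2 fun i => ?_
    have h := Submodule.sum_mem _ fun j (_ : j ∈ Finset.univ) => key i j
    convert h using 1
    refine Prod.ext ?_ ?_
    · rw [Prod.fst_sum]
      exact M.pOp_apply _ _
    · rw [Prod.snd_sum]
      simp only
      rw [PiLp.add_apply, pOp_apply, commP_apply, smul_add, Finset.smul_sum,
        Finset.smul_sum, ← Finset.sum_add_distrib]
      refine Finset.sum_congr rfl fun j _ => congrArg₂ (· + ·) (sgn_smul_sgn_smul i _) ?_
      have hp := congrArg (fun b => S.rho (S.incl b) (S.D ⟨ξ j, hξ j⟩)) (M.p_even i j)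
      simp only [map_smul, smul_apply] at hp
      rw [stdD_apply, map_smul, smul_comm, hp, sgn_smul_sgn_smul]
  obtain ⟨h, e⟩ := mem_graph_iff_exists.1 hg
  exact ⟨h, by rw [e, add_sub_cancel_right]⟩

/-! #### Forms -/

theorem forms_induction {motive : M.Forms → Prop} (zero : motive 0)
    (tmul : ∀ y ω, motive (M.formTmul y ω))
    (add : ∀ Φ Ψ, motive Φ → motive Ψ → motive (Φ + Ψ)) (Φ : M.Forms) : motive Φ := by
  obtain ⟨t, rfl⟩ := Submodule.mkQ_surjective _ Φ
  induction t using TensorProduct.induction_on with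
  | zero => rw [map_zero]; exact zero
  | tmul y ω => exact tmul y ω
  | add t t' h h' => rw [map_add]; exact add _ _ h h'

theorem formsPiD_tmul (y : M.Xv) (ω : S.Omega) :
    M.formsPiD (M.formTmul y ω) = M.tens y ∘L S.piD ω := M.formsLift_tmul _ _ y ω

theorem formsPiDsq_tmul (y : M.Xv) (ω : S.Omega) (h : S.D.domain) :
    M.formsPiDsq (M.formTmul y ω) h = M.tens y (S.piDsq ω h) :=
  DFunLike.congr_fun (M.formsLift_tmul _ _ y ω) h

theorem formsRmul_tmul (b : S.B2) (y : M.Xv) (ω : S.Omega) :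
    M.formsRmul b (M.formTmul y ω) = M.formTmul y (S.ract b ω) := M.formsLift_tmul _ _ y ω

theorem formsGamma_tmul (y : M.Xv) (ω : S.Omega) :
    M.formsGamma (M.formTmul y ω) = M.formTmul (M.XvGamma y) ω := M.formsLift_tmul _ _ y ω

theorem formsCoord_tmul (i : Idx N) (y : M.Xv) (ω : S.Omega) :
    M.formsCoord i (M.formTmul y ω) = S.lact (M.XvVal y i) ω := M.formsLift_tmul _ _ y ω

/-- Left `B₁`-linearity of `π_D` absorbs the coordinate of `y`; this turns represented forms into
operators given by matrices. -/
theorem vH_formsPiD (Φ : M.Forms) (h : H) (i : Idx N) :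
    M.vH (M.formsPiD Φ h) i = S.piD (M.formsCoord i Φ) h := by
  induction Φ using M.forms_induction with
  | zero => simp
  | tmul y ω =>
    rw [formsPiD_tmul, formsCoord_tmul, S.piD_lact]
    rfl
  | add Φ Ψ h1 h2 => simp [h1, h2]

theorem vH_formsPiDsq (Φ : M.Forms) (h : S.D.domain) (i : Idx N) :
    M.vH (M.formsPiDsq Φ h) i = S.piDsq (M.formsCoord i Φ) h := by
  induction Φ using M.forms_induction with
  | zero => simp
  | tmul y ω =>
    rw [formsPiDsq_tmul, formsCoord_tmul, S.piDsq_lact]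
    rfl
  | add Φ Ψ h1 h2 => simp [h1, h2]

theorem formsCoord_formsGamma (i : Idx N) (Φ : M.Forms) :
    M.formsCoord i (M.formsGamma Φ) = sgn i • M.formsCoord i Φ := by
  induction Φ using M.forms_induction with
  | zero => simp
  | tmul y ω =>
    rw [formsGamma_tmul, formsCoord_tmul, formsCoord_tmul, XvVal_XvGamma, map_smul]
    rfl
  | add Φ Ψ h1 h2 => simp [h1, h2]

theorem formsPiD_formsRmul (b : S.B2) (Φ : M.Forms) (h : H) :
    M.formsPiD (M.formsRmul b Φ) h = M.formsPiD Φ (S.rho (S.incl b) h) := by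
  induction Φ using M.forms_induction with
  | zero => simp
  | tmul y ω =>
    rw [formsRmul_tmul, formsPiD_tmul, formsPiD_tmul, S.piD_ract]
    rfl
  | add Φ Ψ h1 h2 => simp [h1, h2]

theorem formsPiDsq_formsRmul (b : S.B2) (Φ : M.Forms) (h : S.D.domain)
    (hb : S.rho (S.incl b) h ∈ S.D.domain) :
    M.formsPiDsq (M.formsRmul b Φ) h = M.formsPiDsq Φ ⟨S.rho (S.incl b) h, hb⟩ := by
  induction Φ using M.forms_induction with
  | zero => simp
  | tmul y ω => rw [formsRmul_tmul, formsPiDsq_tmul, formsPiDsq_tmul, S.piDsq_ract b ω h hb]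
  | add Φ Ψ h1 h2 => simp [h1, h2]

theorem formsGamma_formsRmul (b : S.B2) (Φ : M.Forms) :
    M.formsGamma (M.formsRmul b Φ) = M.formsRmul b (M.formsGamma Φ) := by
  induction Φ using M.forms_induction with
  | zero => simp
  | tmul y ω => simp only [formsRmul_tmul, formsGamma_tmul]
  | add Φ Ψ h1 h2 => simp [h1, h2]

/-! #### The Grassmann connection -/

theorem grassmann_eq (x : X) : M.grassmann x =
    ∑ i, M.formTmul (M.toXv (M.γ (M.frame i))) (S.delta (M.v x i)) := by
  simp only [grassmann, inner_frame]

theorem grassmann_add (x y : X) : M.grassmann (x + y) = M.grassmann x + M.grassmann y := by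
  simp only [grassmann_eq, map_add, Pi.add_apply, Finset.sum_add_distrib]

theorem grassmann_smul (c : ℂ) (x : X) : M.grassmann (c • x) = c • M.grassmann x := by
  simp only [grassmann_eq, v_smul, Pi.smul_apply, map_smul, Finset.smul_sum]

theorem XvRmul_toXv (b : S.B2) (x : X) :
    M.XvRmul (S.incl b) (M.toXv x) = M.toXv (MulOpposite.op b • x) :=
  M.XvVal_injective (funext fun i => by
    rw [XvVal_XvRmul, XvVal_toXv, XvVal_toXv]
    change S.incl _ * S.incl b = S.incl _
    rw [v_op_smul, map_mul])

/-- In `δ(v(x)ᵢ b) = δ(v(x)ᵢ)b + v(x)ᵢ δ(b)` the last coefficient crosses the balanced tensor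
product, and `∑ xᵢ v(x)ᵢ = x`. -/
theorem grassmann_leibniz (x : X) (b : S.B2) : M.grassmann (MulOpposite.op b • x) =
    M.formsRmul b (M.grassmann x) + M.formTmul (M.toXv (M.γ x)) (S.delta b) := by
  simp only [grassmann_eq, v_op_smul, S.delta_mul, map_add, map_sum, formsRmul_tmul,
    Finset.sum_add_distrib, ← formTmul_balanced, XvRmul_toXv, ← map_smul M.γ]
  rw [← LinearMap.sum_apply, ← map_sum, ← map_sum, ← map_sum, M.sum_frame]

/-- As `γ(xᵢ) = εᵢ xᵢ`, the sign of `v(γ(x))ᵢ` moves across the tensor and becomes the second `γ`.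
-/
theorem grassmann_gamma (x : X) : M.grassmann (M.γ x) = M.formsGamma (M.grassmann x) := by
  simp only [grassmann_eq, map_sum, formsGamma_tmul, XvGamma_toXv, M.v_even, gamma_frame,
    map_smul, LinearMap.smul_apply, smul_smul]

theorem formsPiD_grassmann (x : X) (h : H) : M.formsPiD (M.grassmann x) h =
    ∑ i, M.xTens (M.γ (M.frame i)) (S.dD (S.incl (M.v x i)) h) := by
  simp only [grassmann_eq, map_sum, sum_apply, formsPiD_tmul, S.piD_delta]
  rfl

theorem formsPiDsq_formsGamma_grassmann (x : X) (h : S.D.domain) :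
    M.formsPiDsq (M.formsGamma (M.grassmann x)) h =
      ∑ i, M.xTens (M.frame i) (S.dD2 (M.v x i) (S.D h + Complex.I • (h : H))) := by
  simp only [grassmann_eq, map_sum, LinearMap.sum_apply, formsGamma_tmul, XvGamma_toXv, M.γ_γ,
    formsPiDsq_tmul, S.piDsq_delta]
  rfl

end FGPModule

end Curv

end

noncomputable section

namespace Curv

/-! ### The connection form, the two operators and the curvature. -/

namespace FGPModule

variable {H : Type*} [NormedAddCommGroup H] [InnerProductSpace ℂ H] [CompleteSpace H]
variable {S : C2SpectralTriple H} {N : ℕ} {X : Type*} [AddCommGroup X] [Module ℂ X]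
  [Module S.B2ᵐᵒᵖ X] [IsScalarTower ℂ S.B2ᵐᵒᵖ X] {M : FGPModule S N X}

theorem xTens_smul_left (M : FGPModule S N X) (c : ℂ) (x : X) (h : H) :
    M.xTens (c • x) h = c • M.xTens x h := by
  simp [xTens]

theorem xTens_smul_right (M : FGPModule S N X) (c : ℂ) (x : X) (h : H) :
    M.xTens x (c • h) = c • M.xTens x h := map_smul (M.tens (M.toXv x)) c h

theorem xTens_add_right (M : FGPModule S N X) (x : X) (h k : H) :
    M.xTens x (h + k) = M.xTens x h + M.xTens x k := map_add (M.tens (M.toXv x)) h k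

/-- An operator on `X ⊗_B H` with domain in the preimage of `P^{2N}` is given by its values on the
`x ⊗ h` with `h` in `P`. -/
theorem span_eq_graph {P : Submodule ℂ H} {T : M.XH →ₗ.[ℂ] M.XH} {F : X → P → M.XH}
    (hT : ∀ (x : X) (h : P), (M.xTens x h, F x h) ∈ T.graph)
    (hP : ∀ z ∈ T.domain, ∀ i, M.vH z i ∈ P) :
    Submodule.span ℂ (Set.range fun t : X × P => ((M.xTens t.1 t.2, F t.1 t.2) : M.XH × M.XH)) =
      T.graph := by
  refine le_antisymm (Submodule.span_le.2 ?_) ?_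
  · rintro _ ⟨⟨x, h⟩, rfl⟩
    exact hT x h
  · rintro ⟨z, w⟩ hz
    have hd : z ∈ T.domain := LinearPMap.mem_domain_of_mem_graph hz
    have h1 := fun j => hT (M.frame j) ⟨M.vH z j, hP z hd j⟩
    have h2 := Submodule.sum_mem T.graph fun j (_ : j ∈ Finset.univ) => h1 j
    have e1 : (∑ j, ((M.xTens (M.frame j) (M.vH z j), F (M.frame j) ⟨M.vH z j, hP z hd j⟩) :
        M.XH × M.XH)) = (z, w) := by
      have e : (∑ j, ((M.xTens (M.frame j) (M.vH z j), F (M.frame j) ⟨M.vH z j, hP z hd j⟩) :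
        M.XH × M.XH)).1 = z := by
        rw [Prod.fst_sum]
        exact M.sum_xTens_frame z
      -- The frame sum has first coordinate `z`, and a graph is single-valued, so its second
      -- coordinate must be `w`.
      exact Prod.ext e (LinearPMap.mem_graph_snd_inj' T h2 hz e)
    rw [← e1]
    exact Submodule.sum_mem _ fun j _ =>
      Submodule.subset_span ⟨(M.frame j, ⟨M.vH z j, hP z hd j⟩), rfl⟩

namespace C2Connection

variable (nab : M.C2Connection)

/-! #### The connection form -/

/-- The connection form as a linear map. -/
def omegaLin : X →ₗ[ℂ] M.Forms where
  toFun := nab.omega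
  map_add' x y := by
    simp only [omega, map_add, grassmann_add]
    abel
  map_smul' c x := by
    simp only [omega, map_smul, grassmann_smul, smul_sub, RingHom.id_apply]

/-- Both connections have the same inhomogeneous Leibniz term, so their difference is `B₂`-linear
and is determined by its values on the frame. -/
theorem omega_op_smul (x : X) (b : S.B2) :
    nab.omega (MulOpposite.op b • x) = M.formsRmul b (nab.omega x) := by
  rw [omega, omega, nab.leibniz, M.grassmann_leibniz, map_sub]
  abel

theorem omega_gamma (x : X) : nab.omega (M.γ x) = M.formsGamma (nab.omega x) := by
  rw [omega, omega, nab.even, M.grassmann_gamma, map_sub]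

theorem omega_eq_sum (x : X) :
    nab.omega x = ∑ j, M.formsRmul (M.v x j) (nab.omega (M.frame j)) := by
  conv_lhs => rw [← M.sum_frame x]
  simp only [← omega_op_smul]
  exact map_sum nab.omegaLin _ _

/-- Evenness of `ω` together with `γ(xⱼ) = εⱼ xⱼ`: the matrix of `ω` commutes with the grading. This
fixes the signs in the cross terms of the square. -/
theorem sgn_smul_omegaMatrix (i j : Idx N) :
    sgn j • nab.omegaMatrix i j = sgn i • nab.omegaMatrix i j := by
  have h := congrArg (M.formsCoord i) (nab.omega_gamma (M.frame j))
  rw [M.gamma_frame, M.formsCoord_formsGamma] at h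
  have h' : nab.omega (sgn j • M.frame j) = sgn j • nab.omega (M.frame j) :=
    map_smul nab.omegaLin _ _
  rw [h', map_smul] at h
  exact h

/-- The extension of `ω_D` to `H^{2N}` by zero, i.e. `ω_D v*`. -/
def omegaDStd : HN H N →L[ℂ] M.XH :=
  ∑ j, M.formsPiD (nab.omega (M.frame j)) ∘L PiLp.proj 2 (fun _ : Idx N => H) j

theorem omegaDStd_apply (ξ : HN H N) :
    nab.omegaDStd ξ = ∑ j, M.formsPiD (nab.omega (M.frame j)) (ξ j) := by
  simp [omegaDStd]

/-- The bounded operator `ω_D` on `X ⊗_B H`. -/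
def omegaD : M.XH →L[ℂ] M.XH := nab.omegaDStd ∘L M.vH

theorem omegaD_apply (z : M.XH) : nab.omegaD z = nab.omegaDStd (M.vH z) := rfl

theorem omegaD_xTens (x : X) (h : H) :
    nab.omegaD (M.xTens x h) = M.formsPiD (nab.omega x) h := by
  rw [omegaD_apply, omegaDStd_apply, nab.omega_eq_sum x, map_sum, sum_apply]
  simp only [M.formsPiD_formsRmul, vH_xTens]

theorem omegaD_adjoint_vH (ξ : HN H N) :
    nab.omegaD (ContinuousLinearMap.adjoint M.vH ξ) = nab.omegaDStd ξ := by
  rw [M.adjoint_vH_apply, map_sum, omegaDStd_apply]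
  simp only [omegaD_xTens]

theorem vH_omegaDStd (ξ : HN H N) (i : Idx N) :
    M.vH (nab.omegaDStd ξ) i = ∑ j, S.piD (nab.omegaMatrix i j) (ξ j) := by
  rw [omegaDStd_apply, map_sum, WithLp.ofLp_sum, Finset.sum_apply]
  simp only [vH_formsPiD]
  rfl

/-- The operator `(γ ⊗ π_{D²})(ω)` on the preimage of `(Dom D)^{2N}`. -/
def omegaDsq : (stdD S N).domain.comap M.vH.toLinearMap →ₗ[ℂ] M.XH where
  toFun z := ∑ j, M.formsPiDsq (M.formsGamma (nab.omega (M.frame j))) ⟨M.vH z j, z.2 j⟩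
  map_add' z w := by
    rw [← Finset.sum_add_distrib]
    refine Finset.sum_congr rfl fun j _ => ?_
    rw [← map_add]
    exact congrArg _ (Subtype.ext (congrArg (fun ξ : HN H N => ξ j) (map_add M.vH _ _)))
  map_smul' c z := by
    rw [RingHom.id_apply, Finset.smul_sum]
    refine Finset.sum_congr rfl fun j _ => ?_
    rw [← map_smul]
    exact congrArg _ (Subtype.ext (congrArg (fun ξ : HN H N => ξ j) (map_smul M.vH c _)))

theorem omegaDsq_apply (z : (stdD S N).domain.comap M.vH.toLinearMap) : nab.omegaDsq z =
    ∑ j, M.formsPiDsq (M.formsGamma (nab.omega (M.frame j))) ⟨M.vH z j, z.2 j⟩ := rfl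

theorem omegaDsq_xTens (x : X) (h : S.D.domain)
    (hx : M.xTens x h ∈ (stdD S N).domain.comap M.vH.toLinearMap) :
    nab.omegaDsq ⟨M.xTens x h, hx⟩ = M.formsPiDsq (M.formsGamma (nab.omega x)) h := by
  rw [omegaDsq_apply, nab.omega_eq_sum x, map_sum, map_sum, LinearMap.sum_apply]
  refine Finset.sum_congr rfl fun j _ => ?_
  rw [M.formsGamma_formsRmul, M.formsPiDsq_formsRmul _ _ _ (hx j)]
  rfl

theorem vH_omegaDsq (z : (stdD S N).domain.comap M.vH.toLinearMap) (i : Idx N) :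
    M.vH (nab.omegaDsq z) i =
      sgn i • ∑ j, S.piDsq (nab.omegaMatrix i j) ⟨M.vH z j, z.2 j⟩ := by
  rw [omegaDsq_apply, map_sum, WithLp.ofLp_sum, Finset.sum_apply, Finset.smul_sum]
  refine Finset.sum_congr rfl fun j _ => ?_
  rw [vH_formsPiDsq, formsCoord_formsGamma, map_smul]
  rfl

/-! #### Formulas for `1 ⊗_∇ D` and `1 ⊗_∇ D²` -/

/-- The operator `v* (γ ⊗ D) v + ω_D`. -/
def compD : M.XH →ₗ.[ℂ] M.XH where
  domain := (stdD S N).domain.comap M.vH.toLinearMap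
  toFun := (ContinuousLinearMap.adjoint M.vH).toLinearMap ∘ₗ (stdD S N).toFun ∘ₗ
    M.vH.toLinearMap.submoduleComap (stdD S N).domain + nab.omegaD.toLinearMap ∘ₗ
      Submodule.subtype _

theorem compD_apply (z : M.XH) (hz : M.vH z ∈ (stdD S N).domain) :
    nab.compD ⟨z, hz⟩ = ContinuousLinearMap.adjoint M.vH (stdD S N ⟨M.vH z, hz⟩) +
      nab.omegaD z := rfl

/-- The operator `v* (1 ⊗ D²) v + (γ ⊗ π_{D²})(ω)`. -/
def compDsq : M.XH →ₗ.[ℂ] M.XH where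
  domain := (sqPMap (stdD S N)).domain.comap M.vH.toLinearMap
  toFun := (ContinuousLinearMap.adjoint M.vH).toLinearMap ∘ₗ (sqPMap (stdD S N)).toFun ∘ₗ
    M.vH.toLinearMap.submoduleComap (sqPMap (stdD S N)).domain + nab.omegaDsq ∘ₗ
      Submodule.inclusion (Submodule.comap_mono (sqPMap_domain_le _))

theorem compDsq_apply (z : M.XH) (hz : M.vH z ∈ (sqPMap (stdD S N)).domain) :
    nab.compDsq ⟨z, hz⟩ =
      ContinuousLinearMap.adjoint M.vH (sqPMap (stdD S N) ⟨M.vH z, hz⟩) +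
      nab.omegaDsq ⟨z, sqPMap_domain_le _ hz⟩ := rfl

/-- In coordinates `εⱼ D v(x)ⱼ h = εⱼ v(x)ⱼ D h + εⱼ [D, v(x)ⱼ]h`. Summed against the frame, the
first part is `γ(x) ⊗ D h` and the second is the represented Grassmann connection; `ω` supplies the
rest of `∇`. -/
theorem compD_xTens (x : X) (h : S.D.domain) :
    (M.xTens x h, M.xTens (M.γ x) (S.D h) + nab.nablaD x h) ∈ nab.compD.graph := by
  have hx : M.vH (M.xTens x h) ∈ (stdD S N).domain := fun i =>
    (S.isCommutator_rho (S.incl (M.v x i)) h h.2).1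
  refine mem_graph_iff_exists.2 ⟨hx, ?_⟩
  rw [compD_apply, omegaD_xTens]
  have e : nab.toFun x = M.grassmann x + nab.omega x := by
    rw [omega]
    abel
  rw [nablaD, e, map_add, add_apply, ← add_assoc]
  congr 1
  rw [M.formsPiD_grassmann, M.adjoint_vH_apply,
    ← M.sum_xTens_frame (M.xTens (M.γ x) (S.D h)), ← Finset.sum_add_distrib]
  refine Finset.sum_congr rfl fun j _ => ?_
  obtain ⟨h1, e1⟩ := S.isCommutator_rho (S.incl (M.v x j)) h h.2
  have e2 : stdD S N ⟨M.vH (M.xTens x h), hx⟩ j =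
      sgn j • S.D ⟨S.rho (S.incl (M.v x j)) h, h1⟩ := rfl
  have e3 : M.vH (M.xTens (M.γ x) (S.D h)) j = sgn j • S.rho (S.incl (M.v x j)) (S.D h) := by
    rw [vH_xTens, M.v_even, map_smul, map_smul, smul_apply]
  rw [M.gamma_frame, xTens_smul_left, ← xTens_smul_right, ← xTens_add_right, e2, e3, ← smul_add,
    e1, add_sub_cancel]

/-- The same computation with `D² v(x)ⱼ = v(x)ⱼ D² + [D², v(x)ⱼ]`. The signs disappear, because the
`γ` in front of `π_{D²}` cancels the one in the Grassmann connection. -/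
theorem compDsq_xTens (x : X) (h : (sqPMap S.D).domain) :
    (M.xTens x h, M.xTens x (sqPMap S.D h) +
      nab.nablaDsq x ⟨h, sqPMap_domain_le S.D h.2⟩) ∈ nab.compDsq.graph := by
  have hx : M.vH (M.xTens x h) ∈ (sqPMap (stdD S N)).domain :=
    mem_sq_stdD_domain.2 fun i => (S.dD2_apply (M.v x i) h h.2).1
  refine mem_graph_iff_exists.2 ⟨hx, ?_⟩
  rw [compDsq_apply, nab.omegaDsq_xTens x ⟨h, sqPMap_domain_le S.D h.2⟩]
  have e : nab.toFun x = M.grassmann x + nab.omega x := by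
    rw [omega]
    abel
  rw [nablaDsq, e, map_add, map_add, LinearMap.add_apply, ← add_assoc]
  congr 1
  rw [M.formsPiDsq_formsGamma_grassmann, M.adjoint_vH_apply,
    ← M.sum_xTens_frame (M.xTens x (sqPMap S.D h)), ← Finset.sum_add_distrib]
  refine Finset.sum_congr rfl fun j _ => ?_
  obtain ⟨h1, e1⟩ := S.dD2_apply (M.v x j) h h.2
  have e2 : sqPMap (stdD S N) ⟨M.vH (M.xTens x h), hx⟩ j =
      sqPMap S.D ⟨S.rho (S.incl (M.v x j)) h, h1⟩ := sq_stdD_apply _ j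
  rw [← xTens_add_right, e2, vH_xTens, e1, add_sub_cancel]

theorem oneTensD_eq : nab.oneTensD = nab.compD := by
  rw [oneTensD, span_eq_graph (T := nab.compD)
    (F := fun x h => M.xTens (M.γ x) (S.D h) + nab.nablaD x h) nab.compD_xTens fun z hz i => hz i,
    toLinearPMap_graph_self]

theorem oneTensDsq_eq : nab.oneTensDsq = nab.compDsq := by
  rw [oneTensDsq, span_eq_graph (T := nab.compDsq)
    (F := fun x h => M.xTens x (sqPMap S.D h) +
      nab.nablaDsq x ⟨h, sqPMap_domain_le S.D h.2⟩) nab.compDsq_xTens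
    fun z hz i => mem_sq_stdD_domain.1 hz i, toLinearPMap_graph_self]

/-! #### The curvature -/

theorem piDdeltaOmega_apply (ξ : HN H N) (i : Idx N) :
    nab.piDdeltaOmega ξ i = ∑ j, sgn i • S.piDdelta (nab.omegaMatrix i j) (ξ j) :=
  matOp_apply _ _ _

/-- The identity of `piD_mem_graph` applied to each entry `ωᵢⱼ` and summed over `j`. It shows that
`ω_D` maps the preimage of `(Dom D²)^{2N}` into that of `(Dom D)^{2N}`, so the square is defined
there. -/
theorem omegaD_mem_graph (z : M.XH) (hz : M.vH z ∈ (sqPMap (stdD S N)).domain) :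
    (M.vH (nab.omegaD z), nab.piDdeltaOmega (M.vH z) +
      M.vH (nab.omegaDsq ⟨z, sqPMap_domain_le _ hz⟩) -
      M.vH (nab.omegaDStd (stdD S N ⟨M.vH z, sqPMap_domain_le _ hz⟩))) ∈ (stdD S N).graph := by
  refine mem_graph_stdD.2 fun i => ?_
  have h := Submodule.sum_mem S.D.graph fun j (_ : j ∈ Finset.univ) =>
    S.piD_mem_graph ⟨M.vH z j, mem_sq_stdD_domain.1 hz j⟩ (nab.omegaMatrix i j)
  convert h using 1
  refine Prod.ext ?_ ?_
  · rw [Prod.fst_sum, omegaD_apply, vH_omegaDStd]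
  · rw [Prod.snd_sum, PiLp.sub_apply, PiLp.add_apply, piDdeltaOmega_apply, vH_omegaDsq,
      vH_omegaDStd]
    simp only [← Finset.smul_sum]
    rw [smul_sub, smul_add, sgn_smul_sgn_smul, sgn_smul_sgn_smul, Finset.smul_sum,
      ← Finset.sum_add_distrib, ← Finset.sum_sub_distrib]
    refine Finset.sum_congr rfl fun j _ => congrArg _ ?_
    -- The outer sign `εᵢ` and the `εⱼ` in `γ ⊗ D` cancel because `ω` is even.
    have hω := congrArg (fun ω => S.piD ω (stdD S N ⟨M.vH z, sqPMap_domain_le _ hz⟩ j))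
      (nab.sgn_smul_omegaMatrix i j)
    simp only [map_smul, smul_apply] at hω
    rw [← hω, ← map_smul, stdD_apply, sgn_smul_sgn_smul]

/-- With `p² = p` and `v*p = v*`, the vector `v*(D p - p D)pξ` is `v* D pξ - v* D pξ`. -/
theorem adjoint_vH_commP_pOp (ξ : HN H N) (hξ : ξ ∈ (stdD S N).domain) :
    ContinuousLinearMap.adjoint M.vH (M.commP (M.pOp ξ)) = 0 := by
  obtain ⟨h1, -⟩ := M.isCommutator_commP ξ hξ
  obtain ⟨h2, e⟩ := M.isCommutator_commP _ h1
  rw [e, map_sub, M.adjoint_vH_pOp, sub_eq_zero]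
  congr 2
  exact Subtype.ext (M.pOp_pOp ξ)

/-- The bounded extension `v* [D, p] [D, p] v + ω_D² + v* π_D(δ(v ω v*)) v` of the curvature. -/
def curvatureExt : M.XH →L[ℂ] M.XH :=
  ContinuousLinearMap.adjoint M.vH ∘L M.commP ∘L M.commP ∘L M.vH + nab.omegaD ∘L nab.omegaD +
    ContinuousLinearMap.adjoint M.vH ∘L nab.piDdeltaOmega ∘L M.vH

/-- With `ζ = D v z`, the next application of `D` acts on `pζ + vω_D z`. The first summand gives
`[D,p]ζ + pDζ` and the second is given by `omegaD_mem_graph`, whose term `-ω_D v*ζ` cancels the one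
from applying `ω_D` to `v*ζ`. -/
theorem compD_compD (z : M.XH) (hz : M.vH z ∈ (sqPMap (stdD S N)).domain) :
    ∃ h : z ∈ (sqPMap nab.compD).domain,
      sqPMap nab.compD ⟨z, h⟩ = nab.compDsq ⟨z, hz⟩ + nab.curvatureExt z := by
  have hz' := sqPMap_domain_le _ hz
  set ζ := stdD S N ⟨M.vH z, hz'⟩ with hζ
  have hζd : ζ ∈ (stdD S N).domain := hz.2
  obtain ⟨h1, e1⟩ := M.isCommutator_commP ζ hζd
  obtain ⟨h2, e2⟩ := mem_graph_iff_exists.1 (nab.omegaD_mem_graph z hz)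
  have e3 : M.vH (nab.compD ⟨z, hz'⟩) = M.pOp ζ + M.vH (nab.omegaD z) := by
    rw [compD_apply, map_add, M.vH_adjoint_vH]
  have h3 : M.vH (nab.compD ⟨z, hz'⟩) ∈ (stdD S N).domain := by
    rw [e3]
    exact (stdD S N).domain.add_mem h1 h2
  refine ⟨⟨hz', h3⟩, ?_⟩
  rw [sqPMap_apply]
  refine (nab.compD_apply _ h3).trans ?_
  have e4 : stdD S N ⟨M.vH (nab.compD ⟨z, hz'⟩), h3⟩ =
      stdD S N ⟨M.pOp ζ, h1⟩ + stdD S N ⟨M.vH (nab.omegaD z), h2⟩ := by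
    rw [← (stdD S N).map_add]
    congr 1
    exact Subtype.ext e3
  -- Because `p v z = v z`, this commutator is `(1 - p)ζ`. As `v*[D,p]p` vanishes on `ζ`, the term
  -- `v*[D,p]ζ` is then `v*[D,p][D,p]vz`.
  have e5 : M.commP (M.vH z) = ζ - M.pOp ζ := by
    obtain ⟨h, e⟩ := M.isCommutator_commP (M.vH z) hz'
    rw [e, hζ]
    congr 2
    exact Subtype.ext (M.pOp_vH z)
  have e6 : sqPMap (stdD S N) ⟨M.vH z, hz⟩ = stdD S N ⟨ζ, hζd⟩ := rfl
  have e7 : stdD S N ⟨M.pOp ζ, h1⟩ = M.commP ζ + M.pOp (stdD S N ⟨ζ, hζd⟩) := by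
    rw [e1, sub_add_cancel]
  have e8 : nab.omegaD (nab.compD ⟨z, hz'⟩) =
      nab.omegaDStd ζ + nab.omegaD (nab.omegaD z) := by
    rw [compD_apply, map_add, nab.omegaD_adjoint_vH]
  have e9 : nab.curvatureExt z = ContinuousLinearMap.adjoint M.vH (M.commP (M.commP (M.vH z))) +
      nab.omegaD (nab.omegaD z) +
        ContinuousLinearMap.adjoint M.vH (nab.piDdeltaOmega (M.vH z)) := rfl
  rw [e4, e7, e2, e8, e9, e5, compDsq_apply, e6]
  simp only [map_add, map_sub, M.adjoint_vH_pOp, M.adjoint_vH_vH, ← hζ]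
  rw [adjoint_vH_commP_pOp ζ hζd]
  abel

theorem curvature_domain : nab.curvature.domain =
    (sqPMap (stdD S N)).domain.comap M.vH.toLinearMap := by
  rw [curvature, oneTensD_eq, oneTensDsq_eq, LinearPMap.sub_domain]
  -- The difference lives on an intersection of domains; the square of `1 ⊗_∇ D` is defined on all
  -- of the domain of `1 ⊗_∇ D²`.
  exact inf_eq_right.2 fun z hz => (nab.compD_compD z hz).1

theorem curvature_apply (z : nab.curvature.domain) : nab.curvature z = nab.curvatureExt z := by
  -- The operators are varied together with `z`, whose domain depends on them, so that both
  -- identifications can be substituted at once.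
  have key : ∀ (T U : M.XH →ₗ.[ℂ] M.XH), T = nab.compD → U = nab.compDsq →
      ∀ z : (sqPMap T - U).domain, (sqPMap T - U) z = nab.curvatureExt z := by
    rintro _ _ rfl rfl ⟨z, hz⟩
    obtain ⟨h, e⟩ := nab.compD_compD z hz.2
    rw [LinearPMap.sub_apply]
    refine (congrArg (· - _) e).trans ?_
    exact add_sub_cancel_left _ _
  exact key _ _ nab.oneTensD_eq nab.oneTensDsq_eq z

theorem span_xTens_sq_domain : Submodule.span ℂ
    (Set.range fun t : X × (sqPMap S.D).domain => M.xTens t.1 t.2) =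
      (sqPMap (stdD S N)).domain.comap M.vH.toLinearMap := by
  refine le_antisymm (Submodule.span_le.2 ?_) fun z hz => ?_
  · rintro _ ⟨⟨x, h⟩, rfl⟩
    exact mem_sq_stdD_domain.2 fun i => (S.dD2_apply (M.v x i) h h.2).1
  · rw [← M.sum_xTens_frame z]
    exact Submodule.sum_mem _ fun j _ =>
      Submodule.subset_span ⟨(M.frame j, ⟨M.vH z j, mem_sq_stdD_domain.1 hz j⟩), rfl⟩

end C2Connection

/-- In `z = ∑ xⱼ ⊗ (vz)ⱼ` each `(vz)ⱼ` is approximated from `P`, and `h ↦ xⱼ ⊗ h` is continuous. -/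
theorem dense_span_xTens {P : Submodule ℂ H} (hP : Dense (P : Set H)) :
    Dense (Submodule.span ℂ (Set.range fun t : X × P => M.xTens t.1 t.2) : Set M.XH) := by
  rw [Submodule.dense_iff_topologicalClosure_eq_top, Submodule.eq_top_iff']
  intro z
  rw [← M.sum_xTens_frame z]
  refine Submodule.sum_mem _ fun j _ => ?_
  refine map_mem_closure (M.tens (M.toXv (M.frame j))).continuous (hP (M.vH z j)) fun h hh => ?_
  exact Submodule.subset_span ⟨(M.frame j, ⟨h, hh⟩), rfl⟩

end FGPModule

end Curv

end

/-! ### The proposition. -/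

theorem mainTheorem5 {H : Type*} [NormedAddCommGroup H] [InnerProductSpace ℂ H] [CompleteSpace H]
    (S : Curv.C2SpectralTriple H) (N : ℕ) (X : Type*) [AddCommGroup X] [Module ℂ X]
    [Module S.B2ᵐᵒᵖ X] [IsScalarTower ℂ S.B2ᵐᵒᵖ X] (M : Curv.FGPModule S N X)
    (nab : M.C2Connection) :
    (∀ (x : X) (h : H) (hh : h ∈ S.D.domain), ∃ hx : M.xTens x h ∈ nab.oneTensD.domain,
      nab.oneTensD ⟨_, hx⟩ = M.xTens (M.γ x) (S.D ⟨h, hh⟩) + nab.nablaD x h) ∧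
    (∀ (x : X) (h : H) (hh : h ∈ (Curv.sqPMap S.D).domain),
      ∃ hx : M.xTens x h ∈ nab.oneTensDsq.domain, nab.oneTensDsq ⟨_, hx⟩ =
        M.xTens x (Curv.sqPMap S.D ⟨h, hh⟩) +
          nab.nablaDsq x ⟨h, Curv.sqPMap_domain_le S.D hh⟩) ∧
    nab.curvature.domain = Submodule.span ℂ
      (Set.range fun t : X × (Curv.sqPMap S.D).domain => M.xTens t.1 t.2) ∧
    Dense (nab.curvature.domain : Set M.XH) ∧
    ∃ (R W : M.XH →L[ℂ] M.XH)
      (C : Curv.FGPModule.HN H N →L[ℂ] Curv.FGPModule.HN H N),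
      (∀ z : nab.curvature.domain, nab.curvature z = R z) ∧
      (∀ (x : X) (h : H), W (M.xTens x h) = M.formsPiD (nab.omega x) h) ∧
      Curv.IsCommutator (Curv.FGPModule.stdD S N) M.pOp C ∧
      R = ContinuousLinearMap.adjoint M.vH ∘L C ∘L C ∘L M.vH + W ∘L W +
        ContinuousLinearMap.adjoint M.vH ∘L nab.piDdeltaOmega ∘L M.vH := by
  have hdom : nab.curvature.domain = Submodule.span ℂ
      (Set.range fun t : X × (Curv.sqPMap S.D).domain => M.xTens t.1 t.2) := by
    rw [nab.curvature_domain, Curv.FGPModule.C2Connection.span_xTens_sq_domain]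
  refine ⟨fun x h hh => Curv.mem_graph_iff_exists.1 ?_,
    fun x h hh => Curv.mem_graph_iff_exists.1 ?_, hdom, ?_, nab.curvatureExt, nab.omegaD, M.commP,
    nab.curvature_apply, nab.omegaD_xTens, M.isCommutator_commP, rfl⟩
  · rw [nab.oneTensD_eq]
    exact nab.compD_xTens x ⟨h, hh⟩
  · rw [nab.oneTensDsq_eq]
    exact nab.compDsq_xTens x ⟨h, hh⟩
  · rw [hdom]
    exact Curv.FGPModule.dense_span_xTens S.dense_sq_domain
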